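/- **Setting.** Let $x\in\mathbb R/L\mathbb Z$, $v\in\mathbb R$, $t\ge 0$, and let $\mathcal H_n(v)=\widetilde{\mathsf{He}}_n(v)e^{-v^2/2}$ with $\widetilde{\mathsf{He}}_n=(\sqrt{2\pi}\,n!)^{-1/2}\mathsf{He}_n$ and $\mathsf{He}_n$ the probabilists' Hermite polynomials. Let $\mu\in C^1(\mathbb R)$ be a spatially homogeneous equilibrium with $\mu'\in L^1(\mathbb R)$ and $\int\mu^2e^{v^2/2}\,dv<\infty$, let $\bar m_n=\int\mu\,\widetilde{\mathsf{He}}_n\,dv$ and $\mu_{N-1}=\sum_{n=0}^{N-1}\bar m_n\mathcal H_n$. For a function $g(x,t)$ put $\widehat g(\xi,t)=\int_0^L g(x,t)e^{-i\xi x}\,dx$, for a function $g(v)$ put $\widehat g(\eta)=\int g(v)e^{-i\eta v}\,dv$, and let $\mathcal L[g](s)=\int_0^\infty e^{-st}g(t)\,dt$. Put $$\widehat U(\xi,t)=t\,\widehat\mu(t\xi),\qquad \widehat U_{N-1}(\xi,t)=t\,\widehat{\mu_{N-1}}(t\xi),\qquad \mathcal L[\widehat{\mathcal H}_{n}]=\mathcal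 L[\widehat{\mathcal H}_n(\xi\,\cdot)](s).$$ Fix a frequency $\xi=2\pi j/L$ with $j\in\mathbb Z\setminus\{0\}$, and $s\in\mathbb C$ with $\operatorname{Re}s\ge\sigma>0$; all transforms in $x$ and $t$ are taken at $(\xi,s)$, and the Laplace integrals of the controls, of $\widehat{m_N^N}$ and (in part 3) of $\widehat{\delta\rho}$ are assumed to converge absolutely at $s$. Let $\delta f_0(x,v)$ be measurable, periodic in $x$ and integrable over $(0,L]\times\mathbb R$, and let $\delta\rho_F(x,t)=\int\delta f_0(x-vt,v)\,dv$ be its free-streaming density. Let $N\ge1$, and let $H_{VP}(x,t)$, $H_{mom}(x,t)$ be continuous real fields, periodic in $x$. Let $m_0^N,\dots,m_N^N$ be the moments of $f_N=\mu+\sum_{n=0}^N(m_n^N-\bar m_n)\mathcal H_n$, where $\delta f_N=f_N-\mu$ is a classical solution of the linearized truncated kinetic equation with control $H=H_{mom}$, $$\partial_t\delta f_N+v\,\partial_x\delta f_N+(E_N+H)\,\partial_v\mu_{N-1}=\sqrt{N+1}\,\partial_xm_N^N\,\mathcal H_{N+1},\qquad E_N=-\partial_x\phi_N,\quad -\partial_x^2\phi_N=\int\delta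 f_N\,dv,$$ with $\phi_N$ periodic in $x$, and where $\delta f_N(\cdot,\cdot,0)$ and $\delta f_0$ have the same moments $\int(\cdot)\,\widetilde{\mathsf{He}}_n\,dv$, $n\le N$ (as is the case if $\delta f_N(\cdot,\cdot,0)=\delta f_0$). Suppose that the controls are chosen to cancel the self-generated field, that is, $$i\xi\,\mathcal L[\widehat H_{VP}]=-\mathcal L[\widehat{\delta\rho_F}],\qquad i\xi\,\mathcal L[\widehat H_{mom}]=-\mathcal L[\widehat{\delta\rho_F}]+\frac{i\xi\sqrt{N+1}}{\mathcal L[\widehat U_{N-1}]}\,\mathcal L[\widehat{m_N^N}]\,\mathcal L[\widehat{\mathcal H}_{N+1}],$$ and that, with some $c>0$, $|\mathcal L[\widehat U_{M-1}]|\ge c$ for all $M\ge1$. **Proposition.** 1. $\displaystyle\bigl|\mathcal L[\widehat H_{mom}]-\mathcal L[\widehat H_{VP}]\bigr|=\left|\frac{\mathcal L[\widehat{\mathcal H}_{N+1}]}{\mathcal L[\widehat U_{N-1}]}\sqrt{N+1}\,\mathcal L[\widehat{m_N^N}]\right|.$ 2. Let $\mathcal Ag=\partial_vg+vg$ and $\|g\|^2=\int_0^L\!\int_{\mathbb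 R}|g(x,v)|^2e^{v^2/2}\,dv\,dx$. For every integer $k\ge0$ there is a constant $C$ that depends only on $k,L,\sigma,c$ (and not on $N$, $\mu$, $\xi$, $s$, the data or the fields) such that, if $N\ge k$ and $\mu\in C^k$, $$\bigl|\mathcal L[\widehat H_{mom}]-\mathcal L[\widehat H_{VP}]\bigr|\le C\,\frac{\sqrt{N+1}}{N^{k/2}}\int_0^\infty e^{-t\operatorname{Re}s}\,\|\mathcal A^kf_N(\cdot,\cdot,t)\|\,dt,$$ and also $$\bigl|\mathcal L[\widehat H_{mom}]-\mathcal L[\widehat H_{VP}]\bigr|\le C\,\frac{\sqrt{N+1}}{N^{k/2}}\,\sup_{t>0}\|\mathcal A^kf_N(\cdot,\cdot,t)\|$$ (the right-hand sides may be infinite). 3. Apply $H_{mom}$ to the true linearized system: let $\delta f$ be a classical solution of $$\partial_t\delta f+v\,\partial_x\delta f+(E+H_{mom})\,\partial_v\mu=0,\quad E=-\partial_x\phi,\quad -\partial_x^2\phi=\delta\rho=\int\delta f\,dv,\quad \delta f(\cdot,\cdot,0)=\delta f_0,$$ with $\phi$ periodic in $x$ and $E$ continuous, and suppose that $1+\mathcal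 L[\widehat U]\ne0$. Then $$\mathcal L[\widehat{\delta\rho}]=\mathcal L[\widehat{\delta\rho_F}]-\frac{\mathcal L[\widehat U]}{1+\mathcal L[\widehat U]}\,\frac{i\xi\,\mathcal L[\widehat{\mathcal H}_{N+1}]}{\mathcal L[\widehat U_{N-1}]}\,\sqrt{N+1}\,\mathcal L[\widehat{m_N^N}].$$ -/

import Mathlib

open Real Set MeasureTheory
open scoped ENNReal

namespace VlasovControl

noncomputable section

/-! ### Hermite basis, moments, weighted norm -/

/-- Normalised (probabilists') Hermite polynomial `He_n(v) / √(√(2π) n!)`. -/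
def heN (n : ℕ) (v : ℝ) : ℝ :=
  (√(√(2 * π) * (Nat.factorial n : ℝ)))⁻¹ * Polynomial.aeval v (Polynomial.hermite n)

/-- Basis function `ℋ_n(v) = heN n v * exp (-v²/2)`. -/
def hermFun (n : ℕ) (v : ℝ) : ℝ := heN n v * Real.exp (-(v ^ 2) / 2)

/-- The `n`-th moment `m̄_n = ∫ μ(v) heN n v dv` of a function of the velocity. -/
def moment (μ : ℝ → ℝ) (n : ℕ) : ℝ := ∫ v, μ v * heN n v

/-- `muTrunc μ N` is the partial expansion `∑_{n=0}^{N-1} m̄_n ℋ_n`, i.e. `μ_{N-1}`. -/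
def muTrunc (μ : ℝ → ℝ) (N : ℕ) (v : ℝ) : ℝ :=
  ∑ n ∈ Finset.range N, moment μ n * hermFun n v

/-- The approximate distribution `f_N(x,v,t) = μ(v) + ∑_{n=0}^N (m_n(x,t) - m̄_n) ℋ_n(v)`. -/
def fApprox (μ : ℝ → ℝ) (N : ℕ) (m : ℕ → ℝ → ℝ → ℝ) (x v t : ℝ) : ℝ :=
  μ v + ∑ n ∈ Finset.range (N + 1), (m n x t - moment μ n) * hermFun n v

/-- The operator `𝒜 g = ∂_v g + v g`. -/
def opA (g : ℝ → ℝ) (v : ℝ) : ℝ := deriv g v + v * g v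

/-- `(∫_0^L ∫_ℝ |g(x,v)|² exp(v²/2) dv dx)^{1/2}`, possibly infinite. -/
def wNorm (L : ℝ) (g : ℝ → ℝ → ℝ) : ℝ≥0∞ :=
  (∫⁻ x in Ioc 0 L, ∫⁻ v, ENNReal.ofReal (g x v ^ 2 * Real.exp (v ^ 2 / 2))) ^ (1 / 2 : ℝ)

/-- `‖𝒜^k f_N(·,·,t)‖` in the weighted norm, the operator `𝒜` acting in `v`. -/
def wNormAf (L : ℝ) (μ : ℝ → ℝ) (N : ℕ) (m : ℕ → ℝ → ℝ → ℝ) (k : ℕ) (t : ℝ) : ℝ≥0∞ :=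
  wNorm L (fun x => opA^[k] (fun v => fApprox μ N m x v t))

/-! ### Fourier and Laplace transforms -/

/-- Spatial Fourier transform over one period, at the frequency `ξ`. -/
def fourierX (L ξ : ℝ) (g : ℝ → ℝ) : ℂ :=
  ∫ x in (0 : ℝ)..L, Complex.exp (-(Complex.I * ξ * x)) * (g x : ℂ)

/-- Fourier transform in the velocity, `∫ g(v) exp(-i η v) dv`. -/
def fourierV (g : ℝ → ℝ) (η : ℝ) : ℂ :=
  ∫ v : ℝ, Complex.exp (-(Complex.I * η * v)) * (g v : ℂ)

/-- Absolute convergence at `s` of the integral that defines the Laplace transform. -/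
def LaplaceConv (g : ℝ → ℂ) (s : ℂ) : Prop :=
  IntegrableOn (fun t : ℝ => Complex.exp (-(s * t)) * g t) (Ioi 0)

/-- Laplace transform in time. -/
def laplace (g : ℝ → ℂ) (s : ℂ) : ℂ :=
  ∫ t in Ioi (0 : ℝ), Complex.exp (-(s * t)) * g t

/-- `Û(ξ,t) = t μ̂(tξ)`. -/
def Uhat (μ : ℝ → ℝ) (ξ t : ℝ) : ℂ := (t : ℂ) * fourierV μ (t * ξ)

/-- `ℒ[Û(ξ,·)](s)`. -/
def LU (μ : ℝ → ℝ) (ξ : ℝ) (s : ℂ) : ℂ := laplace (Uhat μ ξ) s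

/-- `ℒ[Û_{N-1}(ξ,·)](s)`, the same expression for the truncated equilibrium `μ_{N-1}`. -/
def LUtrunc (μ : ℝ → ℝ) (N : ℕ) (ξ : ℝ) (s : ℂ) : ℂ := LU (muTrunc μ N) ξ s

/-- `ℒ[ℋ̂_n(ξ·)](s)`, with `ℋ̂_n(tξ) = ∫ ℋ_n(v) exp(-i ξ t v) dv`. -/
def LHerm (n : ℕ) (ξ : ℝ) (s : ℂ) : ℂ := laplace (fun t => fourierV (hermFun n) (t * ξ)) s

/-- `ℒ[ĝ(ξ,·)](s)` for a function `g(x,t)` with period `L` in `x`. -/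
def LF (L ξ : ℝ) (g : ℝ → ℝ → ℝ) (s : ℂ) : ℂ := laplace (fun t => fourierX L ξ (fun x => g x t)) s

/-- Absolute convergence of the Laplace integral of `ĝ(ξ,·)` at `s`. -/
def LFConv (L ξ : ℝ) (g : ℝ → ℝ → ℝ) (s : ℂ) : Prop :=
  LaplaceConv (fun t => fourierX L ξ (fun x => g x t)) s

/-! ### Equilibria, data, fields -/

/-- Spatially homogeneous equilibria `μ(v)`. -/
structure IsEquilibrium (μ : ℝ → ℝ) : Prop where
  contDiff : ContDiff ℝ 1 μ
  integrable_deriv : Integrable (deriv μ)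
  weighted : Integrable (fun v => μ v ^ 2 * Real.exp (v ^ 2 / 2))

/-- Initial perturbations `δf_0(x,v)`: periodic in `x` and integrable over a period cell. -/
structure IsInitialData (L : ℝ) (δf₀ : ℝ → ℝ → ℝ) : Prop where
  periodic : ∀ x v, δf₀ (x + L) v = δf₀ x v
  measurable : Measurable (Function.uncurry δf₀)
  integrable : IntegrableOn (Function.uncurry δf₀) (Ioc 0 L ×ˢ univ)

/-- Fields `H(x,t)`, `t ≥ 0`: continuous, periodic in `x`. -/
structure IsForceField (L : ℝ) (H : ℝ → ℝ → ℝ) : Prop where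
  periodic : ∀ x t, 0 ≤ t → H (x + L) t = H x t
  continuousOn : ContinuousOn (Function.uncurry H) (univ ×ˢ Ici 0)

/-- `E` is the electric field of the charge density `q` (electrons minus ions):
`E = -∂_x φ` and `-∂_x² φ = ∂_x E = q` with a potential `φ` that is periodic in `x`. -/
structure IsPoissonField (L : ℝ) (q E : ℝ → ℝ → ℝ) : Prop where
  field : IsForceField L E
  potential : ∃ φ : ℝ → ℝ → ℝ, ∀ t, 0 ≤ t → ∀ x,
    φ (x + L) t = φ x t ∧ HasDerivAt (fun y => φ y t) (-E x t) x
  gauss : ∀ t, 0 ≤ t → ∀ x, HasDerivAt (fun y => E y t) (q x t) x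

/-- Free-streaming density `δρ_F(x,t) = ∫ δf_0(x - v t, v) dv`. -/
def rhoFree (δf₀ : ℝ → ℝ → ℝ) (x t : ℝ) : ℝ := ∫ v, δf₀ (x - v * t) v

/-- Density `∫ g(x,v,t) dv`. -/
def density (g : ℝ → ℝ → ℝ → ℝ) (x t : ℝ) : ℝ := ∫ v, g x v t

/-- `δf(x,v,t)` is a classical solution, with self-consistent field `E`, of the linearised
Vlasov-Poisson system `∂_t δf + v ∂_x δf + (E + H) ∂_v μ = 0`, `∂_x E = δρ`, `δf(t=0) = δf_0`. -/
structure IsLinearizedVP (L : ℝ) (μ : ℝ → ℝ) (H : ℝ → ℝ → ℝ) (δf₀ : ℝ → ℝ → ℝ)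
    (δf : ℝ → ℝ → ℝ → ℝ) (E : ℝ → ℝ → ℝ) : Prop where
  periodic : ∀ x v t, 0 ≤ t → δf (x + L) v t = δf x v t
  continuousOn : ∀ v, ContinuousOn (fun p : ℝ × ℝ => δf p.1 v p.2) (univ ×ˢ Ici 0)
  differentiableAt : ∀ x v t, 0 < t →
    DifferentiableAt ℝ (fun p : ℝ × ℝ => δf p.1 v p.2) (x, t)
  integrable : ∀ x t, 0 ≤ t → Integrable (fun v => δf x v t)
  initial : ∀ x v, δf x v 0 = δf₀ x v
  poisson : IsPoissonField L (density δf) E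
  transport : ∀ x v t, 0 < t →
    deriv (fun τ => δf x v τ) t + v * deriv (fun y => δf y v t) x
      + (E x t + H x t) * deriv μ v = 0

/-- `m_0, …, m_N` are the moments of a classical solution `δf_N = f_N - μ`, with self-consistent
field `E`, of the linearised truncated kinetic equation
`∂_t δf_N + v ∂_x δf_N + (E + H) ∂_v μ_{N-1} = √(N+1) ∂_x m_N ℋ_{N+1}`, `∂_x E = δρ_N`.
Initially, `δf_N` and `δf_0` have the same moments of orders `0, …, N`. -/
structure IsLinearizedTruncated (L : ℝ) (μ : ℝ → ℝ) (N : ℕ) (H : ℝ → ℝ → ℝ)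
    (δf₀ : ℝ → ℝ → ℝ) (m : ℕ → ℝ → ℝ → ℝ) (E : ℝ → ℝ → ℝ) : Prop where
  periodic : ∀ n ≤ N, ∀ x t, 0 ≤ t → m n (x + L) t = m n x t
  continuousOn : ∀ n ≤ N, ContinuousOn (Function.uncurry (m n)) (univ ×ˢ Ici 0)
  differentiableAt : ∀ n ≤ N, ∀ x t, 0 < t →
    DifferentiableAt ℝ (Function.uncurry (m n)) (x, t)
  initial : ∀ n ≤ N, ∀ x, Integrable (fun v => δf₀ x v * heN n v) ∧
    m n x 0 - moment μ n = ∫ v, δf₀ x v * heN n v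
  poisson : IsPoissonField L (density (fun x v t => fApprox μ N m x v t - μ v)) E
  transport : ∀ x v t, 0 < t →
    deriv (fun τ => fApprox μ N m x v τ - μ v) t
      + v * deriv (fun y => fApprox μ N m y v t - μ v) x
      + (E x t + H x t) * deriv (muTrunc μ N) v
      = √((N : ℝ) + 1) * deriv (fun y => m N y t) x * hermFun (N + 1) v

end

end VlasovControl

open VlasovControl

namespace VlasovControl

/-! ### Hermite polynomials -/

/-! The two control laws differ only by the moment term, so subtracting them and dividing by `I * ξ`
gives the exact difference of the controls. Everything else is an estimate of that difference or a
substitution into a Volterra equation.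

The size estimate has three factors. The truncated transform in the denominator is at least `c` in
modulus. The Hermite transform is bounded independently of the index (`norm_LHerm_le`), by
orthonormality and an elementary square. The gain in `N` comes from the last moment: `𝒜` lowers the
index of a Hermite function, and by parts the `n`-th moment of `𝒜 g` is `√(n+1)` times the
`(n+1)`-st moment of `g`. Iterating `k` times expresses `m_N` as `√((N-k)!/N!)` times the `(N-k)`-th
moment of `𝒜^k f_N`. A Bessel inequality bounds that moment by the weighted norm, and `(N-k)!/N! ≤
k^k/N^k` yields the rate (`sq_moment_le`). Cauchy-Schwarz over a period and integration in time
finish the estimate.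

The integrations by parts need decay of the lower iterates, while only the norm of `𝒜^k f_N` may be
taken finite. `GaussL2.of_opA` recovers the decay: `exp (v²/2) g` is a primitive of `exp (v²/2) 𝒜
g`, so a Gaussian bound on `𝒜 g` passes to `g` with a smaller exponent.

For the true system, integration along free trajectories writes the density as its free-streaming
part minus a response to `E + H`. A spatial Fourier coefficient turns the response into a time
convolution with `Uhat`, Gauss's law expresses `E` through the density, and the Laplace transform
makes the relation algebraic (`IsLinearizedVP.laplace_volterra`). Inserting the moment control and
dividing by `1 + LU` gives the density. -/

lemma derivative_hermite_succ (n : ℕ) :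
    Polynomial.derivative (Polynomial.hermite (n + 1))
      = ((n : Polynomial ℤ) + 1) * Polynomial.hermite n := by
  induction n with
  | zero => simp [Polynomial.hermite_succ]
  | succ n ih =>
    have h := Polynomial.hermite_succ n
    rw [Polynomial.hermite_succ (n + 1)]
    simp only [Polynomial.derivative_sub, Polynomial.derivative_mul, Polynomial.derivative_X, ih]
    simp only [Polynomial.derivative_add, Polynomial.derivative_natCast, Polynomial.derivative_one]
    rw [h]
    push_cast
    ring

/-- The normalising factor of `heN n`. -/
noncomputable def heCoeff (n : ℕ) : ℝ := (√(√(2 * π) * (Nat.factorial n : ℝ)))⁻¹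

lemma sqrt_mul_heCoeff_succ (n : ℕ) : √((n : ℝ) + 1) * heCoeff (n + 1) = heCoeff n := by
  have h : √(√(2 * π) * ((n + 1).factorial : ℝ))
      = √((n : ℝ) + 1) * √(√(2 * π) * (n.factorial : ℝ)) := by
    rw [← Real.sqrt_mul (by positivity), Nat.factorial_succ]
    congr 1
    push_cast
    ring
  have h1 : √((n : ℝ) + 1) ≠ 0 := by positivity
  unfold heCoeff
  rw [h, mul_inv, ← mul_assoc, mul_inv_cancel₀ h1, one_mul]

/-- `heN n` as a polynomial. -/
noncomputable def hePoly (n : ℕ) : Polynomial ℝ :=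
  Polynomial.C (heCoeff n) * (Polynomial.hermite n).map (Int.castRingHom ℝ)

lemma heN_eq_eval (n : ℕ) (v : ℝ) : heN n v = (hePoly n).eval v := by
  simp only [heN, hePoly, heCoeff, Polynomial.eval_mul, Polynomial.eval_C,
    Polynomial.aeval_def, Polynomial.eval_map]
  rfl

lemma heN_zero (v : ℝ) : heN 0 v = heCoeff 0 := by
  simp [heN, heCoeff]

lemma hasDerivAt_heN (n : ℕ) (v : ℝ) :
    HasDerivAt (heN n) ((hePoly n).derivative.eval v) v := by
  have h : heN n = fun v => (hePoly n).eval v := funext (heN_eq_eval n)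
  rw [h]
  exact (hePoly n).hasDerivAt v

lemma sqrt_succ_mul_heN_succ (n : ℕ) (v : ℝ) :
    √((n : ℝ) + 1) * heN (n + 1) v = v * heN n v - (hePoly n).derivative.eval v := by
  rw [heN_eq_eval, heN_eq_eval, hePoly, hePoly, Polynomial.hermite_succ]
  simp only [Polynomial.eval_mul, Polynomial.eval_C, Polynomial.map_sub, Polynomial.map_mul,
    Polynomial.map_X, Polynomial.eval_sub, Polynomial.eval_X, Polynomial.derivative_mul,
    Polynomial.derivative_C, zero_mul, zero_add, Polynomial.derivative_map]
  rw [← mul_assoc, sqrt_mul_heCoeff_succ]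
  ring

lemma derivative_hePoly_succ (n : ℕ) (v : ℝ) :
    (hePoly (n + 1)).derivative.eval v = √((n : ℝ) + 1) * heN n v := by
  have h1 : √((n : ℝ) + 1) * √((n : ℝ) + 1) = n + 1 := Real.mul_self_sqrt (by positivity)
  rw [heN_eq_eval, hePoly, hePoly]
  simp only [Polynomial.derivative_mul, Polynomial.derivative_C, zero_mul, zero_add,
    Polynomial.derivative_map, derivative_hermite_succ]
  simp only [Polynomial.eval_mul, Polynomial.eval_C, Polynomial.map_mul, Polynomial.map_add,
    Polynomial.map_natCast, Polynomial.map_one, Polynomial.eval_add, Polynomial.eval_natCast,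
    Polynomial.eval_one]
  rw [← sqrt_mul_heCoeff_succ n]
  linear_combination -(heCoeff (n + 1)
    * ((Polynomial.hermite n).map (Int.castRingHom ℝ)).eval v) * h1

lemma hasDerivAt_exp_half_sq (v : ℝ) :
    HasDerivAt (fun v : ℝ => Real.exp (v ^ 2 / 2)) (v * Real.exp (v ^ 2 / 2)) v := by
  have h : HasDerivAt (fun v : ℝ => v ^ 2 / 2) v v := by
    have := ((hasDerivAt_id v).pow 2).div_const 2
    simpa using this
  simpa [mul_comm] using h.exp

lemma hasDerivAt_exp_neg_half_sq (v : ℝ) :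
    HasDerivAt (fun v : ℝ => Real.exp (-(v ^ 2) / 2)) (-v * Real.exp (-(v ^ 2) / 2)) v := by
  have h : HasDerivAt (fun v : ℝ => -(v ^ 2) / 2) (-v) v := by
    have := ((hasDerivAt_id v).pow 2).neg.div_const 2
    convert! this using 1
    simp
    ring
  simpa [mul_comm] using h.exp

lemma hasDerivAt_hermFun (n : ℕ) (v : ℝ) :
    HasDerivAt (hermFun n)
      ((hePoly n).derivative.eval v * Real.exp (-(v ^ 2) / 2) - v * hermFun n v) v := by
  have := (hasDerivAt_heN n v).mul (hasDerivAt_exp_neg_half_sq v)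
  convert! this using 1
  simp only [hermFun]
  ring

lemma contDiff_hermFun (n : ℕ) (r : WithTop ℕ∞) : ContDiff ℝ r (hermFun n) := by
  have h : hermFun n = fun v => (hePoly n).eval v * Real.exp (-(v ^ 2) / 2) := by
    funext v
    rw [hermFun, heN_eq_eval]
  have h2 : ContDiff ℝ r fun v => (hePoly n).eval v := by
    simpa only [Polynomial.aeval_def, Polynomial.eval₂_eq_eval_map, Algebra.algebraMap_self,
      Polynomial.map_id] using! (hePoly n).contDiff_aeval (𝕜 := ℝ) (n := r)
  rw [h]
  exact h2.mul (((contDiff_id.pow 2).neg.div_const 2).exp)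

/-- Conjugation by the Gaussian turns `𝒜` into plain differentiation of the polynomial factor, which
lowers the Hermite index. -/
lemma opA_hermFun_succ (n : ℕ) (v : ℝ) :
    opA (hermFun (n + 1)) v = √((n : ℝ) + 1) * hermFun n v := by
  rw [opA, (hasDerivAt_hermFun (n + 1) v).deriv, derivative_hePoly_succ]
  simp only [hermFun]
  ring

lemma opA_hermFun_zero (v : ℝ) : opA (hermFun 0) v = 0 := by
  have h : (hePoly 0).derivative = 0 := by simp [hePoly]
  rw [opA, (hasDerivAt_hermFun 0 v).deriv, h]
  simp

/-! ### Gaussian weights -/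

lemma integrable_polynomial_mul_gaussian (p : Polynomial ℝ) {b : ℝ} (hb : 0 < b) :
    Integrable fun v : ℝ => p.eval v * Real.exp (-b * v ^ 2) := by
  induction p using Polynomial.induction_on' with
  | add p q hp hq =>
    simpa only [Polynomial.eval_add, add_mul] using! hp.add hq
  | monomial n a =>
    have h := integrable_rpow_mul_exp_neg_mul_sq hb (s := (n : ℝ))
      (by have : (0 : ℝ) ≤ n := n.cast_nonneg
          linarith)
    simp only [Real.rpow_natCast] at h
    simpa only [Polynomial.eval_monomial, mul_assoc] using! h.const_mul a

/-- Functions that are square integrable against `exp (b v²)` for some `0 < b ≤ 1`. -/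
def GaussL2 (g : ℝ → ℝ) : Prop :=
  ∃ b : ℝ, 0 < b ∧ b ≤ 1 ∧ Integrable fun v => g v ^ 2 * Real.exp (b * v ^ 2)

lemma gaussL2_of_weighted {g : ℝ → ℝ}
    (h : Integrable fun v => g v ^ 2 * Real.exp (v ^ 2 / 2)) : GaussL2 g :=
  ⟨1 / 2, by norm_num, by norm_num, by
    refine h.congr (Filter.Eventually.of_forall fun v => ?_)
    simp only
    congr 2
    ring⟩

lemma GaussL2.integrable_mul_polynomial {g : ℝ → ℝ} (hg : GaussL2 g) (hc : Continuous g)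
    (p : Polynomial ℝ) : Integrable fun v => g v * p.eval v := by
  obtain ⟨b, hb, -, hi⟩ := hg
  have h2 := integrable_polynomial_mul_gaussian (p ^ 2) hb
  refine (hi.add h2).mono' (hc.mul p.continuous).aestronglyMeasurable
    (Filter.Eventually.of_forall fun v => ?_)
  simp only [Pi.add_apply, Polynomial.eval_pow, Real.norm_eq_abs]
  have e1 : Real.exp (b * v ^ 2) * Real.exp (-b * v ^ 2) = 1 := by
    rw [← Real.exp_add]
    simp
  have e2 : Real.exp (b * v ^ 2) = Real.exp (b * v ^ 2 / 2) ^ 2 := by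
    rw [← Real.exp_nat_mul]
    congr 1
    push_cast
    ring
  have e3 : Real.exp (-b * v ^ 2) = Real.exp (-(b * v ^ 2 / 2)) ^ 2 := by
    rw [← Real.exp_nat_mul]
    congr 1
    push_cast
    ring
  have e4 : Real.exp (b * v ^ 2 / 2) * Real.exp (-(b * v ^ 2 / 2)) = 1 := by
    rw [← Real.exp_add]
    simp
  rw [e2, e3, ← mul_pow, ← mul_pow]
  set x := g v * Real.exp (b * v ^ 2 / 2)
  set y := p.eval v * Real.exp (-(b * v ^ 2 / 2))
  have hxy : g v * p.eval v = x * y := by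
    simp only [x, y]
    linear_combination -(g v * p.eval v) * e4
  rw [hxy, abs_le]
  -- This is `|x * y| ≤ x² + y²`, where the Gaussian weight has been split evenly between the two
  -- factors.
  constructor <;> nlinarith [sq_nonneg (x + y), sq_nonneg (x - y), sq_nonneg x, sq_nonneg y]

lemma hasDerivAt_exp_mul {g : ℝ → ℝ} (hg : Differentiable ℝ g) (v : ℝ) :
    HasDerivAt (fun v => Real.exp (v ^ 2 / 2) * g v) (Real.exp (v ^ 2 / 2) * opA g v) v := by
  have := (hasDerivAt_exp_half_sq v).mul (hg v).hasDerivAt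
  convert! this using 1
  simp only [opA]
  ring

lemma continuous_opA {g : ℝ → ℝ} (hg : ContDiff ℝ 1 g) : Continuous (opA g) :=
  (hg.continuous_deriv le_rfl).add (continuous_id.mul hg.continuous)

/-- Integrating `(exp (v²/2) g)' = exp (v²/2) 𝒜 g` from `0` bounds `g` by a linear factor times `exp
(-b v²/2)`. No decay of `g` itself is assumed, which is what lets the moment identity be iterated
from the top iterate downwards. -/
lemma GaussL2.of_opA {g : ℝ → ℝ} (hg : ContDiff ℝ 1 g) (h : GaussL2 (opA g)) : GaussL2 g := by
  obtain ⟨b, hb, hb1, hi⟩ := h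
  have hcA := continuous_opA hg
  set K := ∫ v, opA g v ^ 2 * Real.exp (b * v ^ 2) with hK
  have hK0 : 0 ≤ K := integral_nonneg fun v => by positivity
  have key : ∀ v, |Real.exp (v ^ 2 / 2) * g v|
      ≤ (|g 0| + K + |v|) * Real.exp ((1 - b) * v ^ 2 / 2) := by
    intro v
    have hftc : ∫ u in (0 : ℝ)..v, Real.exp (u ^ 2 / 2) * opA g u
        = Real.exp (v ^ 2 / 2) * g v - g 0 := by
      rw [intervalIntegral.integral_eq_sub_of_hasDerivAt
        (fun u _ => hasDerivAt_exp_mul (hg.differentiable one_ne_zero) u)]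
      · simp
      · apply Continuous.intervalIntegrable
        fun_prop
    have hint : IntervalIntegrable (fun u => opA g u ^ 2 * Real.exp (b * u ^ 2)) volume 0 v :=
      hi.intervalIntegrable
    have hbound : |∫ u in (0 : ℝ)..v, Real.exp (u ^ 2 / 2) * opA g u|
        ≤ |∫ u in (0 : ℝ)..v, (opA g u ^ 2 * Real.exp (b * u ^ 2) + 1)
            * Real.exp ((1 - b) * v ^ 2 / 2)| := by
      refine intervalIntegral.norm_integral_le_abs_of_norm_le
        (f := fun u => Real.exp (u ^ 2 / 2) * opA g u) ?_ ?_
      · refine (ae_restrict_iff' measurableSet_uIoc).2 (Filter.Eventually.of_forall fun u hu => ?_)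
        have huv : u ^ 2 ≤ v ^ 2 := by
          rcases le_total 0 v with h0 | h0
          · rw [uIoc_of_le h0] at hu
            nlinarith [hu.1, hu.2]
          · rw [uIoc_of_ge h0] at hu
            nlinarith [hu.1, hu.2]
        have e1 : Real.exp (u ^ 2 / 2)
            = Real.exp (b * u ^ 2 / 2) * Real.exp ((1 - b) * u ^ 2 / 2) := by
          rw [← Real.exp_add]
          congr 1
          ring
        have e2 : Real.exp (b * u ^ 2) = Real.exp (b * u ^ 2 / 2) ^ 2 := by
          rw [← Real.exp_nat_mul]
          congr 1
          push_cast
          ring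
        -- The restriction `b ≤ 1` in `GaussL2` enters here: the part of the weight not absorbed by
        -- `K` must be largest at the endpoint `v`.
        have e3 : Real.exp ((1 - b) * u ^ 2 / 2) ≤ Real.exp ((1 - b) * v ^ 2 / 2) := by
          apply Real.exp_le_exp.2
          nlinarith
        rw [Real.norm_eq_abs, abs_mul, abs_of_pos (Real.exp_pos _), e1, e2]
        -- This is `y ≤ y² + 1`. After integration the square contributes at most `K`, and the `1`
        -- contributes `|v|`.
        have e4 : Real.exp (b * u ^ 2 / 2) * |opA g u|
            ≤ opA g u ^ 2 * Real.exp (b * u ^ 2 / 2) ^ 2 + 1 := by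
          rw [← sq_abs (opA g u), ← mul_pow]
          nlinarith [sq_nonneg (|opA g u| * Real.exp (b * u ^ 2 / 2) - 1),
            sq_nonneg (|opA g u| * Real.exp (b * u ^ 2 / 2) + 1)]
        calc Real.exp (b * u ^ 2 / 2) * Real.exp ((1 - b) * u ^ 2 / 2) * |opA g u|
            = (Real.exp (b * u ^ 2 / 2) * |opA g u|) * Real.exp ((1 - b) * u ^ 2 / 2) := by ring
          _ ≤ _ := by gcongr
      · exact (hint.add intervalIntegrable_const).mul_const _
    rw [intervalIntegral.integral_mul_const,
      intervalIntegral.integral_add hint intervalIntegrable_const, abs_mul,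
      abs_of_pos (Real.exp_pos _), intervalIntegral.integral_const] at hbound
    have hint2 : |∫ u in (0 : ℝ)..v, opA g u ^ 2 * Real.exp (b * u ^ 2)| ≤ K := by
      rw [← Real.norm_eq_abs]
      refine (intervalIntegral.norm_integral_le_integral_norm_uIoc).trans ?_
      refine (setIntegral_le_integral hi.norm
        (Filter.Eventually.of_forall fun u => norm_nonneg _)).trans (le_of_eq ?_)
      refine integral_congr_ae (Filter.Eventually.of_forall fun u => ?_)
      simp only [Real.norm_eq_abs]
      exact abs_of_nonneg (by positivity)
    have hone : 1 ≤ Real.exp ((1 - b) * v ^ 2 / 2) := by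
      apply Real.one_le_exp
      have : 0 ≤ 1 - b := by linarith
      positivity
    rw [hftc] at hbound
    have h4 := abs_add_le (∫ u in (0 : ℝ)..v, opA g u ^ 2 * Real.exp (b * u ^ 2)) v
    simp only [sub_zero, smul_eq_mul, mul_one] at hbound
    have h5 : |Real.exp (v ^ 2 / 2) * g v| ≤ |g 0| + |Real.exp (v ^ 2 / 2) * g v - g 0| := by
      have := abs_add_le (g 0) (Real.exp (v ^ 2 / 2) * g v - g 0)
      simpa using this
    have h7 : |(∫ u in (0 : ℝ)..v, opA g u ^ 2 * Real.exp (b * u ^ 2)) + v|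
        * Real.exp ((1 - b) * v ^ 2 / 2) ≤ (K + |v|) * Real.exp ((1 - b) * v ^ 2 / 2) := by
      gcongr
      linarith
    have h8 : |g 0| ≤ |g 0| * Real.exp ((1 - b) * v ^ 2 / 2) :=
      le_mul_of_one_le_right (abs_nonneg _) hone
    nlinarith
  -- The square of the pointwise bound decays like `exp (-b v²)` up to a quadratic factor. Half of
  -- this exponent goes to the new weight, the other half keeps the integral finite.
  refine ⟨b / 2, by linarith, by linarith, ?_⟩
  have hp := integrable_polynomial_mul_gaussian
    (Polynomial.C (2 * (|g 0| + K) ^ 2) + Polynomial.C 2 * Polynomial.X ^ 2)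
    (b := b / 2) (by linarith)
  refine hp.mono' (by have := hg.continuous; fun_prop) (Filter.Eventually.of_forall fun v => ?_)
  simp only [Polynomial.eval_add, Polynomial.eval_mul, Polynomial.eval_C, Polynomial.eval_pow,
    Polynomial.eval_X]
  rw [Real.norm_eq_abs, abs_of_nonneg (by positivity)]
  have hk := key v
  rw [abs_mul, abs_of_pos (Real.exp_pos _)] at hk
  have h1 : |g v| ≤ (|g 0| + K + |v|) * Real.exp (-(b * v ^ 2 / 2)) := by
    have e : Real.exp ((1 - b) * v ^ 2 / 2)
        = Real.exp (v ^ 2 / 2) * Real.exp (-(b * v ^ 2 / 2)) := by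
      rw [← Real.exp_add]
      congr 1
      ring
    rw [e] at hk
    refine le_of_mul_le_mul_left ?_ (Real.exp_pos (v ^ 2 / 2))
    linarith
  have h2 : g v ^ 2 ≤ ((|g 0| + K + |v|) * Real.exp (-(b * v ^ 2 / 2))) ^ 2 := by
    rw [← sq_abs (g v)]
    gcongr
  have e3 : Real.exp (-(b * v ^ 2 / 2)) ^ 2 * Real.exp (b / 2 * v ^ 2)
      = Real.exp (-(b / 2) * v ^ 2) := by
    rw [← Real.exp_nat_mul, ← Real.exp_add]
    congr 1
    push_cast
    ring
  calc g v ^ 2 * Real.exp (b / 2 * v ^ 2)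
      ≤ ((|g 0| + K + |v|) * Real.exp (-(b * v ^ 2 / 2))) ^ 2 * Real.exp (b / 2 * v ^ 2) := by
        gcongr
    _ = (|g 0| + K + |v|) ^ 2 * Real.exp (-(b / 2) * v ^ 2) := by
        rw [mul_pow, mul_assoc, e3]
    _ ≤ _ := by
        gcongr
        rw [← sq_abs v]
        nlinarith [sq_nonneg (|g 0| + K - |v|)]

/-! ### Moments and the operator `𝒜` -/

lemma integral_opA_mul_heN {g : ℝ → ℝ} (hg : ContDiff ℝ 1 g) (h : GaussL2 (opA g)) (n : ℕ) :
    ∫ v, opA g v * heN n v = √((n : ℝ) + 1) * ∫ v, g v * heN (n + 1) v := by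
  have hG := GaussL2.of_opA hg h
  have hp := fun p => hG.integrable_mul_polynomial hg.continuous p
  have hA := h.integrable_mul_polynomial (continuous_opA hg) (hePoly n)
  have hX := hp (Polynomial.X * hePoly n)
  -- The derivative has no decay hypothesis of its own; it is recovered as `𝒜 g - v g`, both terms
  -- being integrable against polynomials.
  have hd : Integrable fun v => deriv g v * (hePoly n).eval v := by
    refine (hA.sub hX).congr (Filter.Eventually.of_forall fun v => ?_)
    simp only [Pi.sub_apply, opA, Polynomial.eval_mul, Polynomial.eval_X]
    ring
  have hparts := integral_mul_deriv_eq_deriv_mul_of_integrable (u := (fun v => (hePoly n).eval v))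
    (v := g) (u' := fun v => (hePoly n).derivative.eval v) (v' := deriv g)
    (fun v _ => (hePoly n).hasDerivAt v)
    (fun v _ => (hg.differentiable one_ne_zero v).hasDerivAt)
    (by simpa only [mul_comm] using! hd)
    (by simpa only [mul_comm] using! hp (hePoly n).derivative)
    (by simpa only [mul_comm] using! hp (hePoly n))
  have e1 : ∫ v, opA g v * heN n v
      = (∫ v, (hePoly n).eval v * deriv g v) + ∫ v, g v * (Polynomial.X * hePoly n).eval v := by
    rw [← integral_add (by simpa only [mul_comm] using! hd) hX]
    congr 1
    funext v
    simp only [opA, heN_eq_eval, Polynomial.eval_mul, Polynomial.eval_X]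
    ring
  rw [e1, hparts, ← integral_const_mul, neg_add_eq_sub, ← integral_sub hX
    (by simpa only [mul_comm] using! hp (hePoly n).derivative)]
  congr 1
  funext v
  have := sqrt_succ_mul_heN_succ n v
  rw [heN_eq_eval n] at this
  simp only [Polynomial.eval_mul, Polynomial.eval_X]
  linear_combination (-(g v)) * this

/-- The decay of `g` is proved together with the moment identity, since each integration by parts
requires decay of the next lower iterate. Writing the factor with factorials makes the product of
square roots telescope. -/
lemma iterate_opA {g : ℝ → ℝ} (k n : ℕ) (hg : ContDiff ℝ k g)
    (h : GaussL2 (opA^[k] g)) :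
    GaussL2 g ∧
    (∫ v, opA^[k] g v * heN n v) * √(n.factorial : ℝ)
      = √((n + k).factorial : ℝ) * ∫ v, g v * heN (n + k) v := by
  induction k generalizing g with
  | zero => exact ⟨h, by simp [mul_comm]⟩
  | succ k ih =>
    have hg1 : ContDiff ℝ 1 g := hg.of_le (by norm_cast; omega)
    have hd : ContDiff ℝ k (deriv g) := by
      have : ContDiff ℝ ((k : WithTop ℕ∞) + 1) g := by exact_mod_cast hg
      exact (contDiff_succ_iff_deriv.1 this).2.2
    have hA : ContDiff ℝ k (opA g) :=
      hd.add (contDiff_id.mul (hg.of_le (by norm_cast; omega)))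
    rw [Function.iterate_succ_apply] at h ⊢
    obtain ⟨h1, h2⟩ := ih hA h
    refine ⟨GaussL2.of_opA hg1 h1, ?_⟩
    rw [h2, integral_opA_mul_heN hg1 h1, ← add_assoc, Nat.factorial_succ (n + k), Nat.cast_mul,
      Real.sqrt_mul (by positivity)]
    push_cast
    ring

/-! ### Orthonormality -/

lemma gaussL2_hermFun (n : ℕ) : GaussL2 (hermFun n) := by
  refine gaussL2_of_weighted ?_
  refine (integrable_polynomial_mul_gaussian (hePoly n ^ 2) (b := 1 / 2) (by norm_num)).congr
    (Filter.Eventually.of_forall fun v => ?_)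
  simp only [Polynomial.eval_pow, hermFun, heN_eq_eval]
  rw [mul_pow, mul_assoc, ← Real.exp_nat_mul, ← Real.exp_add]
  congr 2
  push_cast
  ring

lemma continuous_hermFun (n : ℕ) : Continuous (hermFun n) :=
  (contDiff_hermFun n 0).continuous

lemma GaussL2.integrable_mul_heN {g : ℝ → ℝ} (hg : GaussL2 g) (hc : Continuous g) (n : ℕ) :
    Integrable fun v => g v * heN n v := by
  simp only [heN_eq_eval]
  exact hg.integrable_mul_polynomial hc _

lemma gaussL2_zero : GaussL2 (fun _ => 0) := gaussL2_of_weighted (by simp)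

lemma integral_hermFun_zero_mul_heN_succ (n : ℕ) : ∫ v, hermFun 0 v * heN (n + 1) v = 0 := by
  have h0 : opA (hermFun 0) = fun _ => 0 := funext opA_hermFun_zero
  have h := integral_opA_mul_heN (contDiff_hermFun 0 1) (h0 ▸ gaussL2_zero) n
  rw [h0] at h
  simp only [zero_mul, integral_zero] at h
  have h1 : √((n : ℝ) + 1) ≠ 0 := by positivity
  exact (mul_eq_zero.1 h.symm).resolve_left h1

/-- Lowering both indices by `𝒜` reduces orthonormality to the case where one index is zero. There
`𝒜 ℋ_0 = 0` annihilates the higher moments, and the symmetry of the product handles the other order.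
-/
lemma integral_hermFun_mul_heN (m n : ℕ) :
    ∫ v, hermFun m v * heN n v = if m = n then 1 else 0 := by
  induction m generalizing n with
  | zero =>
    cases n with
    | zero =>
      have h : ∀ v, hermFun 0 v * heN 0 v = heCoeff 0 ^ 2 * Real.exp (-(1 / 2) * v ^ 2) := by
        intro v
        simp only [hermFun, heN_zero]
        rw [mul_right_comm, ← pow_two]
        congr 2
        ring
      simp only [h, integral_const_mul, integral_gaussian]
      simp only [heCoeff, Nat.factorial_zero, Nat.cast_one, mul_one, inv_pow]
      rw [Real.sq_sqrt (by positivity)]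
      have : π / (1 / 2) = 2 * π := by ring
      rw [this, inv_mul_cancel₀ (by positivity)]
      simp
    | succ n => simp [integral_hermFun_zero_mul_heN_succ]
  | succ m ih =>
    cases n with
    | zero =>
      have h : ∀ v, hermFun (m + 1) v * heN 0 v = hermFun 0 v * heN (m + 1) v := fun v => by
        simp only [hermFun]
        ring
      simp [h, integral_hermFun_zero_mul_heN_succ]
    | succ n =>
      have h0 : opA (hermFun (m + 1)) = fun v => √((m : ℝ) + 1) * hermFun m v :=
        funext (opA_hermFun_succ m)
      have hG : GaussL2 (opA (hermFun (m + 1))) := by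
        rw [h0]
        obtain ⟨b, hb, hb1, hi⟩ := gaussL2_hermFun m
        refine ⟨b, hb, hb1, (hi.const_mul (√((m : ℝ) + 1) ^ 2)).congr
          (Filter.Eventually.of_forall fun v => ?_)⟩
        simp only
        ring
      have h := integral_opA_mul_heN (contDiff_hermFun (m + 1) 1) hG n
      rw [h0] at h
      simp only [mul_assoc, integral_const_mul, ih] at h
      have h1 : √((n : ℝ) + 1) ≠ 0 := by positivity
      by_cases hmn : m = n
      · subst hmn
        simp only [if_true, mul_one] at h ⊢
        exact (mul_left_cancel₀ h1 (by rw [mul_one]; exact h)).symm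
      · simp only [hmn, if_false, mul_zero, Nat.succ_inj] at h ⊢
        exact (mul_eq_zero.1 h.symm).resolve_left h1

/-! ### Transforms of the Hermite functions -/

lemma hermFun_mul_heN_self (n : ℕ) (v : ℝ) :
    hermFun n v * heN n v = heN n v ^ 2 * Real.exp (-(v ^ 2) / 2) := by
  simp only [hermFun]
  ring

/-- From `|p| ≤ (p² + 1) / 2` under the Gaussian: the square integrates to `1` by orthonormality and
the constant to `√(2π)`. Hence the bound depends neither on the index nor on the frequency. -/
lemma norm_fourierV_hermFun_le (n : ℕ) (η : ℝ) :
    ‖fourierV (hermFun n) η‖ ≤ (1 + √(2 * π)) / 2 := by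
  have hi1 : Integrable fun v => hermFun n v * heN n v :=
    (gaussL2_hermFun n).integrable_mul_heN (continuous_hermFun n) n
  have hi2 : Integrable fun v : ℝ => Real.exp (-(1 / 2) * v ^ 2) :=
    integrable_exp_neg_mul_sq (by norm_num)
  refine (norm_integral_le_of_norm_le ((hi1.add hi2).div_const 2)
    (Filter.Eventually.of_forall fun v => ?_)).trans (le_of_eq ?_)
  · have h1 : (-(Complex.I * η * v)).re = 0 := by simp
    rw [norm_mul, Complex.norm_exp, h1, Real.exp_zero, one_mul, Complex.norm_real,
      Real.norm_eq_abs]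
    simp only [Pi.add_apply, hermFun_mul_heN_self]
    have e : -(1 / 2) * v ^ 2 = -(v ^ 2) / 2 := by ring
    rw [e, hermFun, abs_mul, abs_of_pos (Real.exp_pos _), ← sq_abs (heN n v)]
    nlinarith [mul_nonneg (sq_nonneg (|heN n v| - 1)) (Real.exp_pos (-(v ^ 2) / 2)).le]
  · rw [integral_div]
    simp only [Pi.add_apply]
    rw [integral_add hi1 hi2, integral_hermFun_mul_heN, integral_gaussian]
    have : π / (1 / 2) = 2 * π := by ring
    rw [this]
    simp

lemma norm_cexp_neg_mul (s : ℂ) (t : ℝ) : ‖Complex.exp (-(s * t))‖ = Real.exp (-(s.re * t)) := by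
  rw [Complex.norm_exp]
  simp

lemma integral_exp_neg_mul_Ioi {σ : ℝ} (hσ : 0 < σ) :
    ∫ t in Ioi (0 : ℝ), Real.exp (-σ * t) = 1 / σ := by
  rw [integral_exp_mul_Ioi (by linarith)]
  simp

lemma norm_LHerm_le (n : ℕ) (ξ : ℝ) {σ : ℝ} (hσ : 0 < σ) {s : ℂ} (hs : σ ≤ s.re) :
    ‖LHerm n ξ s‖ ≤ (1 + √(2 * π)) / 2 / σ := by
  have hi : IntegrableOn (fun t => (1 + √(2 * π)) / 2 * Real.exp (-σ * t)) (Ioi 0) :=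
    (integrableOn_exp_mul_Ioi (by linarith) 0).const_mul _
  refine (norm_integral_le_of_norm_le hi ((ae_restrict_iff' measurableSet_Ioi).2
    (Filter.Eventually.of_forall fun t ht => ?_))).trans (le_of_eq ?_)
  · rw [norm_mul, norm_cexp_neg_mul, mul_comm]
    have ht0 : (0 : ℝ) < t := ht
    have h1 : Real.exp (-(s.re * t)) ≤ Real.exp (-σ * t) := by
      apply Real.exp_le_exp.2
      nlinarith
    exact mul_le_mul (norm_fourierV_hermFun_le n _) h1 (Real.exp_pos _).le (by positivity)
  · rw [integral_const_mul, integral_exp_neg_mul_Ioi hσ]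
    ring

/-! ### The size of the last moment -/

/-- Bessel's inequality for a single coefficient: the weighted square norm of `g - a ℋ_n` is
nonnegative and expands to that of `g` minus `a²`. -/
lemma sq_integral_mul_heN_le {g : ℝ → ℝ} (hc : Continuous g)
    (hg : Integrable fun v => g v ^ 2 * Real.exp (v ^ 2 / 2)) (n : ℕ) :
    (∫ v, g v * heN n v) ^ 2 ≤ ∫ v, g v ^ 2 * Real.exp (v ^ 2 / 2) := by
  set a := ∫ v, g v * heN n v with ha
  have hi1 : Integrable fun v => hermFun n v * heN n v :=
    (gaussL2_hermFun n).integrable_mul_heN (continuous_hermFun n) n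
  have hi2 : Integrable fun v => g v * heN n v :=
    (gaussL2_of_weighted hg).integrable_mul_heN hc n
  have h0 : 0 ≤ ∫ v, (g v ^ 2 * Real.exp (v ^ 2 / 2) - 2 * a * (g v * heN n v)
      + a ^ 2 * (hermFun n v * heN n v)) := by
    refine integral_nonneg fun v => ?_
    have e : Real.exp (v ^ 2 / 2) = Real.exp (v ^ 2 / 4) ^ 2 := by
      rw [← Real.exp_nat_mul]
      congr 1
      push_cast
      ring
    have e' : Real.exp (-(v ^ 2) / 2) = Real.exp (-(v ^ 2 / 4)) ^ 2 := by
      rw [← Real.exp_nat_mul]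
      congr 1
      push_cast
      ring
    have e'' : Real.exp (v ^ 2 / 4) * Real.exp (-(v ^ 2 / 4)) = 1 := by
      rw [← Real.exp_add]
      simp
    simp only [Pi.zero_apply]
    rw [hermFun_mul_heN_self, e, e']
    have h := sq_nonneg (g v * Real.exp (v ^ 2 / 4) - a * (heN n v * Real.exp (-(v ^ 2 / 4))))
    refine h.trans (le_of_eq ?_)
    linear_combination (-2 * a * g v * heN n v) * e''
  have hs : Integrable fun v => g v ^ 2 * Real.exp (v ^ 2 / 2) - 2 * a * (g v * heN n v) :=
    hg.sub (hi2.const_mul _)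
  rw [integral_add hs (hi1.const_mul _), integral_sub hg (hi2.const_mul _), integral_const_mul, integral_const_mul, integral_hermFun_mul_heN,
    ← ha] at h0
  simp only [if_true] at h0
  nlinarith

lemma integral_fApprox_mul_heN {μ : ℝ → ℝ} (hμ : IsEquilibrium μ) (N : ℕ) (m : ℕ → ℝ → ℝ → ℝ)
    (x t : ℝ) : ∫ v, fApprox μ N m x v t * heN N v = m N x t := by
  have hi : ∀ n, Integrable fun v => (m n x t - moment μ n) * (hermFun n v * heN N v) :=
    fun n => ((gaussL2_hermFun n).integrable_mul_heN (continuous_hermFun n) N).const_mul _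
  simp only [fApprox, add_mul, Finset.sum_mul, mul_assoc]
  rw [integral_add ((gaussL2_of_weighted hμ.weighted).integrable_mul_heN hμ.contDiff.continuous N)
    (integrable_finsetSum _ fun n _ => hi n), integral_finsetSum _ fun n _ => hi n]
  simp only [integral_const_mul, integral_hermFun_mul_heN]
  simp [moment]

lemma contDiff_fApprox {μ : ℝ → ℝ} {k : ℕ} (hμ : ContDiff ℝ k μ) (N : ℕ) (m : ℕ → ℝ → ℝ → ℝ)
    (x t : ℝ) : ContDiff ℝ k fun v => fApprox μ N m x v t :=
  hμ.add (ContDiff.sum fun n _ => contDiff_const.mul (contDiff_hermFun n k))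

lemma continuous_iterate_opA {g : ℝ → ℝ} (k : ℕ) (hg : ContDiff ℝ k g) :
    Continuous (opA^[k] g) := by
  induction k generalizing g with
  | zero => exact hg.continuous
  | succ k ih =>
    have hd : ContDiff ℝ k (deriv g) := by
      have : ContDiff ℝ ((k : WithTop ℕ∞) + 1) g := by exact_mod_cast hg
      exact (contDiff_succ_iff_deriv.1 this).2.2
    exact ih (hd.add (contDiff_id.mul (hg.of_le (by norm_cast; omega))))

lemma pow_mul_factorial_sub_le {k N : ℕ} (hk : k ≤ N) :
    N ^ k * (N - k).factorial ≤ k ^ k * N.factorial := by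
  rw [← Nat.factorial_mul_descFactorial hk]
  have h : N ^ k ≤ k ^ k * N.descFactorial k := by
    rcases Nat.eq_zero_or_pos k with rfl | h0
    · simp
    · have h1 : N ≤ k * (N + 1 - k) := by
        obtain ⟨d, rfl⟩ := Nat.exists_eq_add_of_le hk
        have : k + d + 1 - k = d + 1 := by omega
        rw [this]
        nlinarith
      calc N ^ k ≤ (k * (N + 1 - k)) ^ k := Nat.pow_le_pow_left h1 k
        _ = k ^ k * (N + 1 - k) ^ k := mul_pow _ _ _
        _ ≤ _ := Nat.mul_le_mul_left _ (Nat.pow_sub_le_descFactorial N k)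
  calc N ^ k * (N - k).factorial ≤ (k ^ k * N.descFactorial k) * (N - k).factorial :=
        Nat.mul_le_mul_right _ h
    _ = _ := by ring

lemma sq_moment_le {g : ℝ → ℝ} {k N : ℕ} (hk : k ≤ N) (hN : 1 ≤ N) (hg : ContDiff ℝ k g)
    (hi : Integrable fun v => opA^[k] g v ^ 2 * Real.exp (v ^ 2 / 2)) :
    (∫ v, g v * heN N v) ^ 2
      ≤ (k : ℝ) ^ k / (N : ℝ) ^ k * ∫ v, opA^[k] g v ^ 2 * Real.exp (v ^ 2 / 2) := by
  have h1 := (iterate_opA k (N - k) hg (gaussL2_of_weighted hi)).2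
  have h2 := sq_integral_mul_heN_le (continuous_iterate_opA k hg) hi (N - k)
  rw [Nat.sub_add_cancel hk] at h1
  set a := ∫ v, opA^[k] g v * heN (N - k) v
  set b := ∫ v, g v * heN N v
  set W := ∫ v, opA^[k] g v ^ 2 * Real.exp (v ^ 2 / 2)
  have h3 : a ^ 2 * ((N - k).factorial : ℝ) = (N.factorial : ℝ) * b ^ 2 := by
    have := congrArg (fun z => z ^ 2) h1
    simp only [mul_pow] at this
    rwa [Real.sq_sqrt (by positivity), Real.sq_sqrt (by positivity)] at this
  have h4 : (N : ℝ) ^ k * ((N - k).factorial : ℝ) ≤ (k : ℝ) ^ k * N.factorial := by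
    exact_mod_cast pow_mul_factorial_sub_le hk
  have hNpos : (0 : ℝ) < (N : ℝ) ^ k := by positivity
  have hf : (0 : ℝ) < N.factorial := by positivity
  rw [div_mul_eq_mul_div, le_div_iff₀ hNpos]
  refine le_of_mul_le_mul_left ?_ hf
  calc (N.factorial : ℝ) * (b ^ 2 * (N : ℝ) ^ k)
      = a ^ 2 * ((N : ℝ) ^ k * ((N - k).factorial : ℝ)) := by
        linear_combination (-(N : ℝ) ^ k) * h3
    _ ≤ W * ((k : ℝ) ^ k * N.factorial) :=
        mul_le_mul h2 h4 (by positivity) ((sq_nonneg a).trans h2)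
    _ = _ := by ring

lemma sq_moment_le_lintegral {g : ℝ → ℝ} {k N : ℕ} (hk : k ≤ N) (hN : 1 ≤ N)
    (hg : ContDiff ℝ k g) :
    ENNReal.ofReal ((∫ v, g v * heN N v) ^ 2) ≤ ENNReal.ofReal ((k : ℝ) ^ k / (N : ℝ) ^ k)
      * ∫⁻ v, ENNReal.ofReal (opA^[k] g v ^ 2 * Real.exp (v ^ 2 / 2)) := by
  -- Strict positivity matters when the weighted integral diverges, since `0 * ⊤ = 0` would not give
  -- a bound. For `k = 0` it rests on `0 ^ 0 = 1`.
  have hD : 0 < (k : ℝ) ^ k / (N : ℝ) ^ k := by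
    have : (0 : ℝ) < (k : ℝ) ^ k := by
      rcases Nat.eq_zero_or_pos k with rfl | h0
      · simp
      · positivity
    positivity
  have hc := continuous_iterate_opA k hg
  have hnn : 0 ≤ᵐ[volume] fun v => opA^[k] g v ^ 2 * Real.exp (v ^ 2 / 2) :=
    Filter.Eventually.of_forall fun v => by simp only [Pi.zero_apply]; positivity
  by_cases hi : Integrable fun v => opA^[k] g v ^ 2 * Real.exp (v ^ 2 / 2)
  · rw [← ofReal_integral_eq_lintegral_ofReal hi hnn, ← ENNReal.ofReal_mul hD.le]
    exact ENNReal.ofReal_le_ofReal (sq_moment_le hk hN hg hi)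
  · have hm : AEStronglyMeasurable (fun v => opA^[k] g v ^ 2 * Real.exp (v ^ 2 / 2)) volume := by
      fun_prop
    have := (lintegral_ofReal_ne_top_iff_integrable hm hnn).not.2 hi
    rw [not_not.1 this, ENNReal.mul_top (by simpa using hD)]
    exact le_top

/-- Cauchy-Schwarz against the constant function `1` on a period, which produces `√L`; the phase has
modulus one. -/
lemma enorm_fourierX_le (L ξ : ℝ) (hL : 0 < L) {g : ℝ → ℝ} (hg : Continuous g) :
    ‖fourierX L ξ g‖ₑ
      ≤ ENNReal.ofReal (√L) * (∫⁻ x in Ioc 0 L, ENNReal.ofReal (g x ^ 2)) ^ (1 / 2 : ℝ) := by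
  rw [fourierX, intervalIntegral.integral_of_le hL.le]
  refine (enorm_integral_le_lintegral_enorm _).trans ?_
  have h1 : ∀ x : ℝ, ‖Complex.exp (-(Complex.I * ξ * x)) * (g x : ℂ)‖ₑ
      = ((fun _ => 1 : ℝ → ℝ≥0∞) * fun x : ℝ => ENNReal.ofReal |g x|) x := by
    intro x
    have h2 : (-(Complex.I * ξ * x)).re = 0 := by simp
    rw [← ofReal_norm, norm_mul, Complex.norm_exp, h2, Real.exp_zero, one_mul,
      Complex.norm_real, Real.norm_eq_abs]
    simp
  simp only [h1]
  refine (ENNReal.lintegral_mul_le_Lp_mul_Lq _ Real.HolderConjugate.two_two aemeasurable_const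
    (by fun_prop)).trans ?_
  refine mul_le_mul' (le_of_eq ?_) (le_of_eq ?_)
  · simp [Real.sqrt_eq_rpow, ENNReal.ofReal_rpow_of_nonneg hL.le]
  · congr 2
    funext x
    rw [ENNReal.ofReal_rpow_of_nonneg (abs_nonneg _) (by norm_num)]
    congr 1
    simp

lemma enorm_fourierX_moment_le {L : ℝ} (ξ : ℝ) (hL : 0 < L) {μ : ℝ → ℝ} (hμ : IsEquilibrium μ)
    {k N : ℕ} (hk : k ≤ N) (hN : 1 ≤ N) (hμk : ContDiff ℝ k μ) (m : ℕ → ℝ → ℝ → ℝ) (t : ℝ)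
    (hm : Continuous fun x => m N x t) :
    ‖fourierX L ξ (fun x => m N x t)‖ₑ
      ≤ ENNReal.ofReal (√L * (√((k : ℝ) ^ k) / (N : ℝ) ^ ((k : ℝ) / 2)))
        * wNormAf L μ N m k t := by
  refine (enorm_fourierX_le L ξ hL hm).trans ?_
  rw [ENNReal.ofReal_mul (by positivity), mul_assoc]
  refine mul_le_mul_right ?_ _
  have hD : ENNReal.ofReal (√((k : ℝ) ^ k) / (N : ℝ) ^ ((k : ℝ) / 2))
      = ENNReal.ofReal ((k : ℝ) ^ k / (N : ℝ) ^ k) ^ (1 / 2 : ℝ) := by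
    rw [ENNReal.ofReal_rpow_of_nonneg (by positivity) (by norm_num), Real.div_rpow (by positivity)
      (by positivity), ← Real.sqrt_eq_rpow, ← Real.rpow_natCast (N : ℝ),
      ← Real.rpow_mul (by positivity)]
    congr 3
    ring
  rw [hD, wNormAf, wNorm, ← ENNReal.mul_rpow_of_nonneg _ _ (by norm_num)]
  refine ENNReal.rpow_le_rpow ?_ (by norm_num)
  rw [← lintegral_const_mul' _ _ ENNReal.ofReal_ne_top]
  refine lintegral_mono fun x => ?_
  have := sq_moment_le_lintegral hk hN (contDiff_fApprox hμk N m x t)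
  rwa [integral_fApprox_mul_heN hμ] at this

lemma ofReal_norm_LF_moment_le {L : ℝ} (ξ : ℝ) (hL : 0 < L) {μ : ℝ → ℝ} (hμ : IsEquilibrium μ)
    {k N : ℕ} (hk : k ≤ N) (hN : 1 ≤ N) (hμk : ContDiff ℝ k μ) (m : ℕ → ℝ → ℝ → ℝ) (s : ℂ)
    (hm : ContinuousOn (Function.uncurry (m N)) (univ ×ˢ Ici 0)) :
    ENNReal.ofReal ‖LF L ξ (m N) s‖
      ≤ ENNReal.ofReal (√L * (√((k : ℝ) ^ k) / (N : ℝ) ^ ((k : ℝ) / 2)))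
        * ∫⁻ t in Ioi (0 : ℝ), ENNReal.ofReal (Real.exp (-(s.re * t))) * wNormAf L μ N m k t := by
  rw [ofReal_norm, LF, laplace]
  refine (enorm_integral_le_lintegral_enorm _).trans ?_
  rw [← lintegral_const_mul' _ _ ENNReal.ofReal_ne_top]
  refine setLIntegral_mono' measurableSet_Ioi fun t ht => ?_
  rw [enorm_mul, ← ofReal_norm, norm_cexp_neg_mul, mul_left_comm]
  refine mul_le_mul_right (enorm_fourierX_moment_le ξ hL hμ hk hN hμk m t ?_) _
  have ht0 : (0 : ℝ) < t := ht
  have h2 : Continuous fun x : ℝ => ((x, t) : ℝ × ℝ) := by fun_prop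
  exact hm.comp_continuous h2 fun x => ⟨mem_univ _, ht0.le⟩

lemma lintegral_exp_mul_le_iSup {σ : ℝ} (hσ : 0 < σ) {r : ℝ} (hr : σ ≤ r) (F : ℝ → ℝ≥0∞) :
    ∫⁻ t in Ioi (0 : ℝ), ENNReal.ofReal (Real.exp (-(r * t))) * F t
      ≤ ENNReal.ofReal (1 / σ) * ⨆ t ∈ Ioi (0 : ℝ), F t := by
  have h1 : ∫⁻ t in Ioi (0 : ℝ), ENNReal.ofReal (Real.exp (-σ * t)) = ENNReal.ofReal (1 / σ) := by
    rw [← ofReal_integral_eq_lintegral_ofReal (integrableOn_exp_mul_Ioi (by linarith) 0)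
      (Filter.Eventually.of_forall fun t => (Real.exp_pos _).le), integral_exp_neg_mul_Ioi hσ]
  rw [← h1, ← lintegral_mul_const _ (by fun_prop)]
  refine setLIntegral_mono' measurableSet_Ioi fun t ht => ?_
  refine mul_le_mul' (ENNReal.ofReal_le_ofReal (Real.exp_le_exp.2 ?_))
    (le_iSup₂ (f := fun t _ => F t) t ht)
  have ht0 : (0 : ℝ) < t := ht
  nlinarith

/-! ### Force fields along free trajectories -/

/-- The field `H`, frozen at its initial value for negative times. -/
def extendField (H : ℝ → ℝ → ℝ) (x t : ℝ) : ℝ := H x (max t 0)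

lemma extendField_of_nonneg (H : ℝ → ℝ → ℝ) (x : ℝ) {t : ℝ} (ht : 0 ≤ t) :
    extendField H x t = H x t := by
  rw [extendField, max_eq_left ht]

lemma IsForceField.continuous_extendField {L : ℝ} {H : ℝ → ℝ → ℝ} (hH : IsForceField L H) :
    Continuous (Function.uncurry (extendField H)) := by
  have h : Continuous fun p : ℝ × ℝ => ((p.1, max p.2 0) : ℝ × ℝ) := by fun_prop
  exact hH.continuousOn.comp_continuous h fun p =>
    ⟨mem_univ _, le_max_right p.2 0⟩

lemma IsForceField.extendField_periodic {L : ℝ} {H : ℝ → ℝ → ℝ} (hH : IsForceField L H)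
    (x t : ℝ) : extendField H (x + L) t = extendField H x t :=
  hH.periodic x _ (le_max_right _ _)

lemma IsForceField.add {L : ℝ} {E H : ℝ → ℝ → ℝ} (hE : IsForceField L E)
    (hH : IsForceField L H) : IsForceField L fun x t => E x t + H x t where
  periodic x t ht := by rw [hE.periodic x t ht, hH.periodic x t ht]
  continuousOn := hE.continuousOn.add hH.continuousOn

/-- Periodicity reduces the bound to one compact cell, so it is uniform over arbitrarily fast
trajectories. -/
lemma exists_bound_of_periodic {L : ℝ} (hL : 0 < L) {G : ℝ → ℝ → ℝ}
    (hc : Continuous (Function.uncurry G)) (hp : ∀ x t, G (x + L) t = G x t) (T : ℝ) :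
    ∃ B, ∀ x, ∀ τ ∈ Icc 0 T, |G x τ| ≤ B := by
  obtain ⟨B, hB⟩ := ((isCompact_Icc (a := (0 : ℝ)) (b := L)).prod
    (isCompact_Icc (a := (0 : ℝ)) (b := T))).exists_bound_of_continuousOn hc.continuousOn
  refine ⟨B, fun x τ hτ => ?_⟩
  have hper : Function.Periodic G L := fun x => funext fun t => hp x t
  obtain ⟨y, hy, hxy⟩ := hper.exists_mem_Ico₀ hL x
  rw [hxy]
  exact hB (y, τ) ⟨Ico_subset_Icc_self hy, hτ⟩

/-- The integral `∫_0^t G(x - v (t - τ), τ) dτ` of a field along the free trajectory that is at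
`(x, v)` at time `t`. -/
noncomputable def trajInt (G : ℝ → ℝ → ℝ) (t x v : ℝ) : ℝ :=
  ∫ τ in (0 : ℝ)..t, G (x - v * (t - τ)) τ

lemma continuous_trajInt {G : ℝ → ℝ → ℝ} (hc : Continuous (Function.uncurry G)) (t : ℝ) :
    Continuous (Function.uncurry (trajInt G t)) := by
  refine intervalIntegral.continuous_parametric_intervalIntegral_of_continuous'
    (f := fun (p : ℝ × ℝ) τ => G (p.1 - p.2 * (t - τ)) τ) ?_ 0 t
  have h : Continuous fun q : (ℝ × ℝ) × ℝ => ((q.1.1 - q.1.2 * (t - q.2), q.2) : ℝ × ℝ) := by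
    fun_prop
  exact hc.comp h

lemma exists_bound_trajInt {L : ℝ} (hL : 0 < L) {G : ℝ → ℝ → ℝ}
    (hc : Continuous (Function.uncurry G)) (hp : ∀ x t, G (x + L) t = G x t) {t : ℝ}
    (ht : 0 ≤ t) : ∃ B, ∀ x v, |trajInt G t x v| ≤ B := by
  obtain ⟨B, hB⟩ := exists_bound_of_periodic hL hc hp t
  refine ⟨B * |t - 0|, fun x v => ?_⟩
  rw [← Real.norm_eq_abs]
  refine intervalIntegral.norm_integral_le_of_norm_le_const fun τ hτ => ?_
  rw [uIoc_of_le ht] at hτ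
  exact hB _ τ (Ioc_subset_Icc_self hτ)

/-! ### Solution along characteristics -/

/-- The chain rule turns the transport operator into a derivative along a trajectory; joint
differentiability is what makes this legitimate. -/
lemma hasDerivAt_along_trajectory {F : ℝ × ℝ → ℝ} {x v τ : ℝ} (y : ℝ → ℝ)
    (hy : HasDerivAt y v τ) (hyx : y τ = x) (hF : DifferentiableAt ℝ F (x, τ)) :
    HasDerivAt (fun r => F (y r, r))
      (deriv (fun r => F (x, r)) τ + v * deriv (fun z => F (z, τ)) x) τ := by
  have h1 : HasDerivAt (fun r => F (x, r)) (fderiv ℝ F (x, τ) (0, 1)) τ :=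
    hF.hasFDerivAt.comp_hasDerivAt (f := fun r => (x, r)) τ
      ((hasDerivAt_const τ x).prodMk (hasDerivAt_id τ))
  have h2 : HasDerivAt (fun z => F (z, τ)) (fderiv ℝ F (x, τ) (1, 0)) x :=
    hF.hasFDerivAt.comp_hasDerivAt (f := fun z => (z, τ)) x
      ((hasDerivAt_id x).prodMk (hasDerivAt_const x τ))
  have hF' : HasFDerivAt F (fderiv ℝ F (x, τ)) (y τ, τ) := hyx ▸ hF.hasFDerivAt
  have h3 : HasDerivAt (fun r => F (y r, r)) (fderiv ℝ F (x, τ) (v, 1)) τ :=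
    hF'.comp_hasDerivAt (f := fun r => (y r, r)) τ (hy.prodMk (hasDerivAt_id τ))
  have h4 : ((v, 1) : ℝ × ℝ) = (0, 1) + v • (1, 0) := by simp
  rw [h4, map_add, map_smul, smul_eq_mul] at h3
  rwa [h1.deriv, h2.deriv]

/-- Duhamel's formula: the velocity is constant along a free trajectory, so `deriv μ v` factors out
of the time integral. -/
lemma IsLinearizedVP.eq_trajInt {L : ℝ} {μ : ℝ → ℝ} {H δf₀ E : ℝ → ℝ → ℝ}
    {δf : ℝ → ℝ → ℝ → ℝ} (h : IsLinearizedVP L μ H δf₀ δf E) (hH : IsForceField L H)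
    (x v : ℝ) {t : ℝ} (ht : 0 ≤ t) :
    δf x v t = δf₀ (x - v * t) v
      - trajInt (extendField fun x t => E x t + H x t) t x v * deriv μ v := by
  have hF := h.poisson.field.add hH
  have hc := hF.continuous_extendField
  set G := extendField fun x t => E x t + H x t with hG
  have hcy : Continuous fun τ : ℝ => ((x - v * (t - τ), τ) : ℝ × ℝ) := by fun_prop
  have hftc := intervalIntegral.integral_eq_sub_of_hasDerivAt_of_le ht
    (f := fun τ => δf (x - v * (t - τ)) v τ)
    (f' := fun τ => G (x - v * (t - τ)) τ * (-deriv μ v)) ?_ ?_ ?_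
  · rw [intervalIntegral.integral_mul_const] at hftc
    simp only [sub_self, mul_zero, sub_zero, h.initial] at hftc
    rw [trajInt]
    linarith
  · exact (h.continuousOn v).comp hcy.continuousOn fun τ hτ => ⟨mem_univ _, hτ.1⟩
  · intro τ hτ
    have hy : HasDerivAt (fun r => x - v * (t - r)) v τ := by
      have := (((hasDerivAt_id τ).const_sub t).const_mul v).const_sub x
      simpa using this
    have h1 := hasDerivAt_along_trajectory (F := fun p => δf p.1 v p.2) _ hy rfl
      (h.differentiableAt _ v τ hτ.1)
    have h2 := h.transport (x - v * (t - τ)) v τ hτ.1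
    convert! h1 using 1
    rw [hG, extendField_of_nonneg _ _ hτ.1.le]
    simp only
    linarith
  · exact ((hc.comp hcy).mul continuous_const).intervalIntegrable _ _

/-! ### The density -/

lemma integrable_trajInt_mul_deriv {L : ℝ} (hL : 0 < L) {μ : ℝ → ℝ} (hμ : IsEquilibrium μ)
    {G : ℝ → ℝ → ℝ} (hc : Continuous (Function.uncurry G)) (hp : ∀ x t, G (x + L) t = G x t)
    {t : ℝ} (ht : 0 ≤ t) (ν : Measure ℝ) [IsFiniteMeasure ν] :
    Integrable (fun p : ℝ × ℝ => trajInt G t p.1 p.2 * deriv μ p.2) (ν.prod volume) := by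
  obtain ⟨B, hB⟩ := exists_bound_trajInt hL hc hp ht
  exact (hμ.integrable_deriv.comp_snd ν).bdd_mul (c := B)
    (continuous_trajInt hc t).aestronglyMeasurable (Filter.Eventually.of_forall fun p => hB _ _)

lemma integrable_trajInt_mul_deriv_snd {L : ℝ} (hL : 0 < L) {μ : ℝ → ℝ} (hμ : IsEquilibrium μ)
    {G : ℝ → ℝ → ℝ} (hc : Continuous (Function.uncurry G)) (hp : ∀ x t, G (x + L) t = G x t)
    {t : ℝ} (ht : 0 ≤ t) (x : ℝ) : Integrable fun v => trajInt G t x v * deriv μ v := by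
  obtain ⟨B, hB⟩ := exists_bound_trajInt hL hc hp ht
  have h : Continuous fun v : ℝ => ((x, v) : ℝ × ℝ) := by fun_prop
  exact hμ.integrable_deriv.bdd_mul (c := B)
    ((continuous_trajInt hc t).comp h).aestronglyMeasurable
    (Filter.Eventually.of_forall fun v => hB _ _)

/-- Density of the response to a field. -/
noncomputable def rhoResponse (μ : ℝ → ℝ) (G : ℝ → ℝ → ℝ) (t x : ℝ) : ℝ :=
  ∫ v, trajInt G t x v * deriv μ v

lemma IsLinearizedVP.density_eq {L : ℝ} (hL : 0 < L) {μ : ℝ → ℝ} (hμ : IsEquilibrium μ)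
    {H δf₀ E : ℝ → ℝ → ℝ} {δf : ℝ → ℝ → ℝ → ℝ} (h : IsLinearizedVP L μ H δf₀ δf E)
    (hH : IsForceField L H) (x : ℝ) {t : ℝ} (ht : 0 ≤ t) :
    density δf x t = rhoFree δf₀ x t
      - rhoResponse μ (extendField fun x t => E x t + H x t) t x := by
  have hF := h.poisson.field.add hH
  have hi := integrable_trajInt_mul_deriv_snd hL hμ hF.continuous_extendField
    hF.extendField_periodic ht x
  -- Integrability of the free-streaming data on every line comes from that of the solution and of
  -- the response; integrability over a cell would give it only for almost every `x`.
  have hi0 : Integrable fun v => δf₀ (x - v * t) v := by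
    refine ((h.integrable x t ht).add hi).congr (Filter.Eventually.of_forall fun v => ?_)
    simp only [Pi.add_apply]
    rw [h.eq_trajInt hH x v ht]
    ring
  rw [density, rhoFree, rhoResponse, ← integral_sub hi0 hi]
  exact integral_congr_ae (Filter.Eventually.of_forall fun v => h.eq_trajInt hH x v ht)

lemma intervalIntegrable_rhoResponse {L : ℝ} (hL : 0 < L) {μ : ℝ → ℝ} (hμ : IsEquilibrium μ)
    {G : ℝ → ℝ → ℝ} (hc : Continuous (Function.uncurry G)) (hp : ∀ x t, G (x + L) t = G x t)
    {t : ℝ} (ht : 0 ≤ t) : IntervalIntegrable (rhoResponse μ G t) volume 0 L := by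
  rw [intervalIntegrable_iff_integrableOn_Ioc_of_le hL.le]
  exact (integrable_trajInt_mul_deriv hL hμ hc hp ht (volume.restrict (Ioc 0 L))).integral_prod_left

/-- The shear `(x, v) ↦ (x - v t, v)` translates each fibre in `x`, and periodicity makes the
integral over a period invariant under translation. Fubini then gives integrability of the density.
-/
lemma intervalIntegrable_rhoFree {L : ℝ} (hL : 0 < L) {δf₀ : ℝ → ℝ → ℝ}
    (h : IsInitialData L δf₀) (t : ℝ) :
    IntervalIntegrable (fun x => rhoFree δf₀ x t) volume 0 L := by
  rw [intervalIntegrable_iff_integrableOn_Ioc_of_le hL.le]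
  have h0 : Integrable (Function.uncurry δf₀) ((volume.restrict (Ioc 0 L)).prod volume) := by
    have := h.integrable
    rwa [IntegrableOn, Measure.volume_eq_prod, ← Measure.prod_restrict,
      Measure.restrict_univ] at this
  have hper : ∀ v, Function.Periodic (fun x => δf₀ x v) L := fun v x => h.periodic x v
  obtain ⟨h1, h2⟩ := (integrable_prod_iff' h0.aestronglyMeasurable).1 h0
  have hmeas : Measurable fun p : ℝ × ℝ => δf₀ (p.1 - p.2 * t) p.2 := by
    have hm : Measurable fun p : ℝ × ℝ => ((p.1 - p.2 * t, p.2) : ℝ × ℝ) := by fun_prop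
    exact h.measurable.comp hm
  have h3 : Integrable (fun p : ℝ × ℝ => δf₀ (p.1 - p.2 * t) p.2)
      ((volume.restrict (Ioc 0 L)).prod volume) := by
    rw [integrable_prod_iff' hmeas.aestronglyMeasurable]
    constructor
    · filter_upwards [h1] with v hv
      have hv' : IntervalIntegrable (fun x => δf₀ x v) volume 0 L :=
        (intervalIntegrable_iff_integrableOn_Ioc_of_le hL.le).2 hv
      have := ((hper v).intervalIntegrable₀ hL.ne' hv' (0 - v * t) (L - v * t)).comp_sub_right
        (v * t)
      simp only [sub_add_cancel] at this
      exact (intervalIntegrable_iff_integrableOn_Ioc_of_le hL.le).1 this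
    · refine h2.congr (Filter.Eventually.of_forall fun v => ?_)
      have hpn : Function.Periodic (fun x => ‖δf₀ x v‖) L := fun x => by simp only [h.periodic]
      simp only [Function.uncurry_apply_pair]
      rw [← intervalIntegral.integral_of_le hL.le, ← intervalIntegral.integral_of_le hL.le,
        intervalIntegral.integral_comp_sub_right (fun x => ‖δf₀ x v‖)]
      have := hpn.intervalIntegral_add_eq 0 (0 - v * t)
      rw [zero_add] at this
      rw [this]
      congr 1
      ring
  exact h3.integral_prod_left

/-! ### Spatial Fourier coefficients -/

lemma continuous_phase (ξ : ℝ) : Continuous fun x : ℝ => Complex.exp (-(Complex.I * ξ * x)) := by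
  fun_prop

lemma hasDerivAt_phase (ξ x : ℝ) :
    HasDerivAt (fun x : ℝ => Complex.exp (-(Complex.I * ξ * x)))
      (-(Complex.I * ξ) * Complex.exp (-(Complex.I * ξ * x))) x := by
  have h1 : HasDerivAt (fun x : ℝ => -(Complex.I * ξ * x)) (-(Complex.I * ξ)) x := by
    have := ((hasDerivAt_id x).ofReal_comp.const_mul (Complex.I * ξ)).neg
    convert! this using 1
    simp
  simpa [mul_comm] using h1.cexp

lemma norm_phase (ξ x : ℝ) : ‖Complex.exp (-(Complex.I * ξ * x))‖ = 1 := by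
  have h : (-(Complex.I * ξ * x)).re = 0 := by simp
  rw [Complex.norm_exp, h, Real.exp_zero]

lemma phase_period {L ξ : ℝ} (hL : 0 < L) {j : ℤ} (hξ : ξ = 2 * π * j / L) :
    Complex.exp (-(Complex.I * ξ * L)) = 1 := by
  have h : -(Complex.I * ξ * L) = ((-j : ℤ) : ℂ) * (2 * π * Complex.I) := by
    have hL' : (L : ℂ) ≠ 0 := by exact_mod_cast hL.ne'
    rw [hξ]
    push_cast
    field_simp
  rw [h, Complex.exp_int_mul_two_pi_mul_I]

lemma phase_add (ξ x y : ℝ) : Complex.exp (-(Complex.I * ξ * ((x + y : ℝ) : ℂ)))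
    = Complex.exp (-(Complex.I * ξ * x)) * Complex.exp (-(Complex.I * ξ * y)) := by
  rw [← Complex.exp_add]
  congr 1
  push_cast
  ring

lemma intervalIntegral_comm_of_continuous {F : ℝ → ℝ → ℂ} (hF : Continuous (Function.uncurry F))
    {a b : ℝ} (hab : a ≤ b) (c d : ℝ) :
    ∫ y in c..d, ∫ x in a..b, F x y = ∫ x in a..b, ∫ y in c..d, F x y := by
  simp only [intervalIntegral.integral_of_le hab]
  rw [intervalIntegral_integral_swap]
  rw [Measure.prod_restrict]
  have hF' : Continuous (Function.uncurry fun y x => F x y) := hF.comp continuous_swap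
  exact (hF'.continuousOn.integrableOn_compact (μ := volume.prod volume)
    (isCompact_uIcc.prod isCompact_Icc)).mono_set
    (prod_mono uIoc_subset_uIcc Ioc_subset_Icc_self)

/-- The integrand with its phase is `L`-periodic at an admissible frequency, so the shifted window
may be moved back to the original period. -/
lemma fourierX_comp_sub {L ξ : ℝ} (he : Complex.exp (-(Complex.I * ξ * L)) = 1) {g : ℝ → ℝ}
    (hp : ∀ x, g (x + L) = g x) (a : ℝ) :
    fourierX L ξ (fun x => g (x - a)) = Complex.exp (-(Complex.I * ξ * a)) * fourierX L ξ g := by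
  set P : ℝ → ℂ := fun x => Complex.exp (-(Complex.I * ξ * x)) * (g x : ℂ) with hP
  have hper : Function.Periodic P L := fun x => by
    simp only [hP, phase_add, he, hp, mul_one]
  have h1 : ∀ x : ℝ, Complex.exp (-(Complex.I * ξ * x)) * (g (x - a) : ℂ)
      = Complex.exp (-(Complex.I * ξ * a)) * P (x - a) := fun x => by
    simp only [hP]
    rw [← mul_assoc, ← Complex.exp_add]
    congr 2
    push_cast
    ring
  rw [fourierX]
  simp only [h1]
  rw [intervalIntegral.integral_const_mul, intervalIntegral.integral_comp_sub_right P]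
  have := hper.intervalIntegral_add_eq (0 - a) 0
  rw [zero_add, show 0 - a + L = L - a by ring] at this
  rw [this, fourierX]

lemma continuous_fourierX {L ξ : ℝ} {G : ℝ → ℝ → ℝ} (hc : Continuous (Function.uncurry G)) :
    Continuous fun t => fourierX L ξ fun x => G x t := by
  refine intervalIntegral.continuous_parametric_intervalIntegral_of_continuous'
    (f := fun (t x : ℝ) => Complex.exp (-(Complex.I * ξ * x)) * (G x t : ℂ)) ?_ 0 L
  have h : Continuous fun p : ℝ × ℝ => G p.2 p.1 := hc.comp continuous_swap
  have h1 : Continuous fun p : ℝ × ℝ => Complex.exp (-(Complex.I * ξ * p.2)) := by fun_prop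
  exact h1.mul (Complex.continuous_ofReal.comp h)

lemma fourierX_trajInt {L ξ : ℝ} (hL : 0 < L) (he : Complex.exp (-(Complex.I * ξ * L)) = 1)
    {G : ℝ → ℝ → ℝ} (hc : Continuous (Function.uncurry G)) (hp : ∀ x t, G (x + L) t = G x t)
    (t v : ℝ) :
    fourierX L ξ (fun x => trajInt G t x v)
      = ∫ τ in (0 : ℝ)..t,
          Complex.exp (-(Complex.I * ξ * ((v * (t - τ) : ℝ) : ℂ))) * fourierX L ξ fun x => G x τ := by
  have hF : Continuous (Function.uncurry fun x τ : ℝ =>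
      Complex.exp (-(Complex.I * ξ * x)) * (G (x - v * (t - τ)) τ : ℂ)) := by
    have h : Continuous fun p : ℝ × ℝ => ((p.1 - v * (t - p.2), p.2) : ℝ × ℝ) := by fun_prop
    have h1 : Continuous fun p : ℝ × ℝ => Complex.exp (-(Complex.I * ξ * p.1)) := by fun_prop
    exact h1.mul (Complex.continuous_ofReal.comp (hc.comp h))
  have h1 : ∀ τ, Complex.exp (-(Complex.I * ξ * ((v * (t - τ) : ℝ) : ℂ)))
        * (fourierX L ξ fun x => G x τ)
      = ∫ x in (0 : ℝ)..L, Complex.exp (-(Complex.I * ξ * x)) * (G (x - v * (t - τ)) τ : ℂ) :=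
    fun τ => (fourierX_comp_sub he (g := fun x => G x τ) (fun x => hp x τ) (v * (t - τ))).symm
  simp only [h1]
  rw [intervalIntegral_comm_of_continuous hF hL.le, fourierX]
  simp only [trajInt, ← intervalIntegral.integral_ofReal, ← intervalIntegral.integral_const_mul]

/-! ### Fourier transform of the equilibrium -/

lemma IsEquilibrium.integrable {μ : ℝ → ℝ} (hμ : IsEquilibrium μ) : Integrable μ := by
  have := (gaussL2_of_weighted hμ.weighted).integrable_mul_polynomial hμ.contDiff.continuous 1
  simpa using this

lemma fourierV_deriv {μ : ℝ → ℝ} (hμ : IsEquilibrium μ) (η : ℝ) :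
    fourierV (deriv μ) η = Complex.I * η * fourierV μ η := by
  have hm : ∀ {g : ℝ → ℝ}, Integrable g →
      Integrable fun v : ℝ => Complex.exp (-(Complex.I * η * v)) * (g v : ℂ) := fun hg =>
    hg.ofReal.bdd_mul (c := 1) (continuous_phase η).aestronglyMeasurable
      (Filter.Eventually.of_forall fun v => (norm_phase η v).le)
  have h := integral_mul_deriv_eq_deriv_mul_of_integrable
    (u := fun v : ℝ => Complex.exp (-(Complex.I * η * v))) (v := fun v => (μ v : ℂ))
    (u' := fun v => -(Complex.I * η) * Complex.exp (-(Complex.I * η * v)))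
    (v' := fun v => ((deriv μ v : ℝ) : ℂ)) (fun v _ => hasDerivAt_phase η v)
    (fun v _ => (hμ.contDiff.differentiable one_ne_zero v).hasDerivAt.ofReal_comp)
    (hm hμ.integrable_deriv)
    (((hm hμ.integrable).const_mul (-(Complex.I * η))).congr
      (Filter.Eventually.of_forall fun v => by simp [mul_assoc]))
    (hm hμ.integrable)
  rw [fourierV, h, fourierV, ← integral_const_mul, ← integral_neg]
  congr 1
  funext v
  ring

lemma fourierV_deriv_eq_Uhat {μ : ℝ → ℝ} (hμ : IsEquilibrium μ) (ξ t : ℝ) :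
    fourierV (deriv μ) (t * ξ) = Complex.I * ξ * Uhat μ ξ t := by
  rw [fourierV_deriv hμ, Uhat]
  push_cast
  ring

lemma continuous_fourierV {g : ℝ → ℝ} (hg : Integrable g) : Continuous (fourierV g) := by
  refine continuous_of_dominated (bound := fun v => ‖g v‖) (fun η => ?_)
    (fun η => Filter.Eventually.of_forall fun v => ?_) hg.norm
    (Filter.Eventually.of_forall fun v => by fun_prop)
  · exact (continuous_phase η).aestronglyMeasurable.mul
      hg.ofReal.aestronglyMeasurable
  · rw [norm_mul, norm_phase, one_mul, Complex.norm_real]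

lemma norm_fourierV_le (g : ℝ → ℝ) (η : ℝ) : ‖fourierV g η‖ ≤ ∫ v, ‖g v‖ := by
  refine (norm_integral_le_integral_norm _).trans (le_of_eq ?_)
  congr 1
  funext v
  rw [norm_mul, norm_phase, one_mul, Complex.norm_real]

/-- The factor `t` is harmless: up to `I * ξ`, `Uhat` is the Fourier transform of `deriv μ`, hence
bounded because `deriv μ` is integrable and `ξ ≠ 0`. -/
lemma laplaceConv_Uhat {μ : ℝ → ℝ} (hμ : IsEquilibrium μ) {ξ : ℝ} (hξ : ξ ≠ 0) {s : ℂ}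
    (hs : 0 < s.re) : LaplaceConv (Uhat μ ξ) s := by
  have hi : IntegrableOn (fun t : ℝ => Complex.exp (-(s * t))) (Ioi 0) := by
    refine (integrableOn_exp_mul_Ioi (a := -s.re) (by linarith) 0).mono'
      (Continuous.aestronglyMeasurable (by fun_prop)) (Filter.Eventually.of_forall fun t => ?_)
    rw [norm_cexp_neg_mul, neg_mul]
  have hc : Continuous (Uhat μ ξ) := by
    have := continuous_fourierV hμ.integrable
    unfold Uhat
    fun_prop
  refine hi.mul_bdd (c := (∫ v, ‖deriv μ v‖) / |ξ|) hc.aestronglyMeasurable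
    (Filter.Eventually.of_forall fun t => ?_)
  rw [le_div_iff₀ (abs_pos.2 hξ)]
  have := norm_fourierV_le (deriv μ) (t * ξ)
  rw [fourierV_deriv_eq_Uhat hμ, norm_mul, norm_mul, Complex.norm_I, one_mul, Complex.norm_real,
    Real.norm_eq_abs] at this
  linarith

/-! ### The response in Fourier variables -/

/-- Shifting along the trajectory yields the phase `exp (-I ξ v (t - τ))`. Integrating it against
`deriv μ` produces `I ξ Uhat (t - τ)`, so the response becomes a convolution in time. -/
lemma fourierX_rhoResponse {L ξ : ℝ} (hL : 0 < L) (he : Complex.exp (-(Complex.I * ξ * L)) = 1)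
    {μ : ℝ → ℝ} (hμ : IsEquilibrium μ) {G : ℝ → ℝ → ℝ} (hc : Continuous (Function.uncurry G))
    (hp : ∀ x t, G (x + L) t = G x t) {t : ℝ} (ht : 0 ≤ t) :
    fourierX L ξ (rhoResponse μ G t)
      = Complex.I * ξ * ∫ τ in (0 : ℝ)..t, (fourierX L ξ fun x => G x τ) * Uhat μ ξ (t - τ) := by
  have hi1 : Integrable (Function.uncurry fun x v : ℝ =>
      Complex.exp (-(Complex.I * ξ * x)) * ((trajInt G t x v * deriv μ v : ℝ) : ℂ))
      ((volume.restrict (uIoc 0 L)).prod volume) := by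
    have : IsFiniteMeasure (volume.restrict (uIoc 0 L)) := by
      rw [uIoc_of_le hL.le]
      infer_instance
    refine (integrable_trajInt_mul_deriv hL hμ hc hp ht _).ofReal.bdd_mul (c := 1)
      (f := fun p : ℝ × ℝ => Complex.exp (-(Complex.I * ξ * p.1)))
      (Continuous.aestronglyMeasurable (by fun_prop))
      (Filter.Eventually.of_forall fun p => (norm_phase ξ p.1).le)
  have hK : Continuous fun τ => fourierX L ξ fun x => G x τ := continuous_fourierX hc
  obtain ⟨B, hB⟩ := (isCompact_uIcc (a := (0 : ℝ)) (b := t)).exists_bound_of_continuousOn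
    hK.continuousOn
  have hi2 : Integrable (Function.uncurry fun τ v : ℝ =>
      (Complex.exp (-(Complex.I * ξ * ((v * (t - τ) : ℝ) : ℂ))) * fourierX L ξ fun x => G x τ)
        * ((deriv μ v : ℝ) : ℂ)) ((volume.restrict (uIoc 0 t)).prod volume) := by
    have : IsFiniteMeasure (volume.restrict (uIoc 0 t)) := by
      rw [uIoc_of_le ht]
      infer_instance
    have h0 : Integrable (fun p : ℝ × ℝ => ((deriv μ p.2 : ℝ) : ℂ))
        ((volume.restrict (uIoc 0 t)).prod volume) := (hμ.integrable_deriv.comp_snd _).ofReal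
    refine h0.bdd_mul (c := B)
      (f := fun p : ℝ × ℝ => Complex.exp (-(Complex.I * ξ * ((p.2 * (t - p.1) : ℝ) : ℂ)))
        * fourierX L ξ fun x => G x p.1)
      (Continuous.aestronglyMeasurable ?_) ?_
    · have h1 : Continuous fun p : ℝ × ℝ => fourierX L ξ fun x => G x p.1 :=
        hK.comp continuous_fst
      fun_prop
    · have hae : ∀ᵐ τ ∂(volume.restrict (uIoc 0 t)), τ ∈ uIoc 0 t :=
        ae_restrict_mem measurableSet_uIoc
      filter_upwards [Measure.quasiMeasurePreserving_fst.ae hae] with p hp'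
      rw [norm_mul, norm_phase, one_mul]
      exact hB _ (uIoc_subset_uIcc hp')
  calc fourierX L ξ (rhoResponse μ G t)
      = ∫ x in (0 : ℝ)..L, ∫ v, Complex.exp (-(Complex.I * ξ * x))
          * ((trajInt G t x v * deriv μ v : ℝ) : ℂ) := by
        refine intervalIntegral.integral_congr fun x _ => ?_
        rw [integral_const_mul]
        congr 1
        exact integral_ofReal.symm
    _ = ∫ v, ∫ x in (0 : ℝ)..L, Complex.exp (-(Complex.I * ξ * x))
          * ((trajInt G t x v * deriv μ v : ℝ) : ℂ) := intervalIntegral_integral_swap hi1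
    _ = ∫ v, ∫ τ in (0 : ℝ)..t, (Complex.exp (-(Complex.I * ξ * ((v * (t - τ) : ℝ) : ℂ)))
          * fourierX L ξ fun x => G x τ) * ((deriv μ v : ℝ) : ℂ) := by
        congr 1
        funext v
        rw [intervalIntegral.integral_mul_const, ← fourierX_trajInt hL he hc hp, fourierX,
          ← intervalIntegral.integral_mul_const]
        congr 1
        funext x
        push_cast
        ring
    _ = ∫ τ in (0 : ℝ)..t, ∫ v, (Complex.exp (-(Complex.I * ξ * ((v * (t - τ) : ℝ) : ℂ)))
          * fourierX L ξ fun x => G x τ) * ((deriv μ v : ℝ) : ℂ) :=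
        (intervalIntegral_integral_swap hi2).symm
    _ = ∫ τ in (0 : ℝ)..t, Complex.I * ξ
          * ((fourierX L ξ fun x => G x τ) * Uhat μ ξ (t - τ)) := by
        congr 1
        funext τ
        have h1 : ∀ v : ℝ, (Complex.exp (-(Complex.I * ξ * ((v * (t - τ) : ℝ) : ℂ)))
            * fourierX L ξ fun x => G x τ) * ((deriv μ v : ℝ) : ℂ)
            = (fourierX L ξ fun x => G x τ)
              * (Complex.exp (-(Complex.I * (((t - τ) * ξ : ℝ) : ℂ) * v)) * ((deriv μ v : ℝ) : ℂ)) := by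
          intro v
          have : Complex.I * ξ * ((v * (t - τ) : ℝ) : ℂ)
              = Complex.I * (((t - τ) * ξ : ℝ) : ℂ) * v := by
            push_cast
            ring
          rw [this]
          ring
        simp only [h1, integral_const_mul]
        have h2 := fourierV_deriv_eq_Uhat hμ ξ (t - τ)
        rw [fourierV] at h2
        rw [h2]
        ring
    _ = _ := intervalIntegral.integral_const_mul _ _

lemma intervalIntegrable_phase_mul {L : ℝ} (ξ : ℝ) {g : ℝ → ℝ}
    (hg : IntervalIntegrable g volume 0 L) :
    IntervalIntegrable (fun x : ℝ => Complex.exp (-(Complex.I * ξ * x)) * (g x : ℂ)) volume 0 L :=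
  ⟨hg.1.ofReal.bdd_mul (c := 1) (continuous_phase ξ).aestronglyMeasurable
      (Filter.Eventually.of_forall fun v => (norm_phase ξ v).le),
    hg.2.ofReal.bdd_mul (c := 1) (continuous_phase ξ).aestronglyMeasurable
      (Filter.Eventually.of_forall fun v => (norm_phase ξ v).le)⟩

lemma fourierX_sub {L : ℝ} (ξ : ℝ) {g h : ℝ → ℝ} (hg : IntervalIntegrable g volume 0 L)
    (hh : IntervalIntegrable h volume 0 L) :
    fourierX L ξ (fun x => g x - h x) = fourierX L ξ g - fourierX L ξ h := by
  rw [fourierX, fourierX, fourierX, ← intervalIntegral.integral_sub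
    (intervalIntegrable_phase_mul ξ hg) (intervalIntegrable_phase_mul ξ hh)]
  congr 1
  funext x
  push_cast
  ring

lemma fourierX_add {L : ℝ} (ξ : ℝ) {g h : ℝ → ℝ} (hg : IntervalIntegrable g volume 0 L)
    (hh : IntervalIntegrable h volume 0 L) :
    fourierX L ξ (fun x => g x + h x) = fourierX L ξ g + fourierX L ξ h := by
  rw [fourierX, fourierX, fourierX, ← intervalIntegral.integral_add
    (intervalIntegrable_phase_mul ξ hg) (intervalIntegrable_phase_mul ξ hh)]
  congr 1
  funext x
  push_cast
  ring

lemma fourierX_deriv {L ξ : ℝ} (he : Complex.exp (-(Complex.I * ξ * L)) = 1) {g g' : ℝ → ℝ}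
    (hp : g L = g 0) (hd : ∀ x, HasDerivAt g (g' x) x)
    (hi : IntervalIntegrable g' volume 0 L) :
    fourierX L ξ g' = Complex.I * ξ * fourierX L ξ g := by
  have h := intervalIntegral.integral_mul_deriv_eq_deriv_mul (a := 0) (b := L)
    (u := fun x : ℝ => Complex.exp (-(Complex.I * ξ * x))) (v := fun x => (g x : ℂ))
    (u' := fun x => -(Complex.I * ξ) * Complex.exp (-(Complex.I * ξ * x)))
    (v' := fun x => (g' x : ℂ)) (fun x _ => hasDerivAt_phase ξ x) (fun x _ => (hd x).ofReal_comp)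
    (Continuous.intervalIntegrable (by fun_prop) _ _) ⟨hi.1.ofReal, hi.2.ofReal⟩
  rw [fourierX, h, he, hp]
  simp only [mul_assoc, intervalIntegral.integral_const_mul]
  simp [fourierX, mul_assoc]

/-! ### Laplace transform of a convolution -/

/-- The factorisation `exp (-s t) = exp (-s τ) exp (-s (t - τ))` moves the damping into the two
factors, which are then integrable on the half-line. -/
lemma laplace_integrand_conv (a b : ℝ → ℂ) (s : ℂ) (t : ℝ) :
    Complex.exp (-(s * t)) * ∫ τ in (0 : ℝ)..t, a τ * b (t - τ)
      = ∫ τ in (0 : ℝ)..t, ContinuousLinearMap.mul ℝ ℂ (Complex.exp (-(s * τ)) * a τ)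
          (Complex.exp (-(s * ((t - τ : ℝ) : ℂ))) * b (t - τ)) := by
  rw [← intervalIntegral.integral_const_mul]
  congr 1
  funext τ
  have : Complex.exp (-(s * t))
      = Complex.exp (-(s * τ)) * Complex.exp (-(s * ((t - τ : ℝ) : ℂ))) := by
    rw [← Complex.exp_add]
    congr 1
    push_cast
    ring
  rw [this, ContinuousLinearMap.mul_apply']
  ring

lemma laplaceConv_conv {a b : ℝ → ℂ} {s : ℂ} (ha : LaplaceConv a s) (hb : LaplaceConv b s) :
    LaplaceConv (fun t => ∫ τ in (0 : ℝ)..t, a τ * b (t - τ)) s := by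
  have h := integrable_posConvolution (μ := volume) (ν := volume) ha hb
    (ContinuousLinearMap.mul ℝ ℂ)
  unfold posConvolution at h
  rw [integrable_indicator_iff measurableSet_Ioi] at h
  unfold LaplaceConv
  simp only [laplace_integrand_conv]
  exact h

lemma laplace_conv {a b : ℝ → ℂ} {s : ℂ} (ha : LaplaceConv a s) (hb : LaplaceConv b s) :
    laplace (fun t => ∫ τ in (0 : ℝ)..t, a τ * b (t - τ)) s = laplace a s * laplace b s := by
  have h := integral_posConvolution (μ := volume) (ν := volume) ha hb
    (ContinuousLinearMap.mul ℝ ℂ)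
  unfold laplace
  simp only [laplace_integrand_conv]
  exact h

lemma LaplaceConv.const_mul {a : ℝ → ℂ} {s : ℂ} (ha : LaplaceConv a s) (c : ℂ) :
    LaplaceConv (fun t => c * a t) s := by
  refine (Integrable.const_mul ha c).congr (Filter.Eventually.of_forall fun t => ?_)
  simp only
  ring

lemma LaplaceConv.add {a b : ℝ → ℂ} {s : ℂ} (ha : LaplaceConv a s) (hb : LaplaceConv b s) :
    LaplaceConv (fun t => a t + b t) s := by
  refine (Integrable.add ha hb).congr (Filter.Eventually.of_forall fun t => ?_)
  simp only [Pi.add_apply]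
  ring

lemma laplace_const_mul (a : ℝ → ℂ) (s c : ℂ) :
    laplace (fun t => c * a t) s = c * laplace a s := by
  unfold laplace
  rw [← integral_const_mul]
  congr 1
  funext t
  ring

lemma laplace_add {a b : ℝ → ℂ} {s : ℂ} (ha : LaplaceConv a s) (hb : LaplaceConv b s) :
    laplace (fun t => a t + b t) s = laplace a s + laplace b s := by
  unfold laplace
  rw [← integral_add ha hb]
  congr 1
  funext t
  ring

lemma laplace_congr {a b : ℝ → ℂ} {s : ℂ} (h : ∀ t, 0 < t → a t = b t) :
    laplace a s = laplace b s :=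
  setIntegral_congr_fun measurableSet_Ioi fun t ht => by simp only [h t ht]

lemma LaplaceConv.congr {a b : ℝ → ℂ} {s : ℂ} (ha : LaplaceConv a s)
    (h : ∀ t, 0 < t → a t = b t) : LaplaceConv b s :=
  IntegrableOn.congr_fun ha (fun t ht => by simp only [h t ht]) measurableSet_Ioi

/-- The Volterra equation of the linearised system in Fourier-Laplace variables. -/
lemma IsLinearizedVP.laplace_volterra {L ξ : ℝ} (hL : 0 < L) (hξ0 : ξ ≠ 0)
    (he : Complex.exp (-(Complex.I * ξ * L)) = 1) {μ : ℝ → ℝ} (hμ : IsEquilibrium μ)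
    {H δf₀ E : ℝ → ℝ → ℝ} {δf : ℝ → ℝ → ℝ → ℝ} (h : IsLinearizedVP L μ H δf₀ δf E)
    (hf₀ : IsInitialData L δf₀) (hH : IsForceField L H) {s : ℂ} (hs : 0 < s.re)
    (hHs : LFConv L ξ H s) (hρs : LFConv L ξ (density δf) s) :
    LF L ξ (rhoFree δf₀) s = LF L ξ (density δf) s
      + (LF L ξ (density δf) s + Complex.I * ξ * LF L ξ H s) * LU μ ξ s := by
  have hE := h.poisson.field
  have hF := hE.add hH
  have hc := hF.continuous_extendField
  have hp := hF.extendField_periodic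
  have hIξ : Complex.I * (ξ : ℂ) ≠ 0 :=
    mul_ne_zero Complex.I_ne_zero (by exact_mod_cast hξ0)
  set G := extendField fun x t => E x t + H x t with hG
  have hcont : ∀ {K : ℝ → ℝ → ℝ}, IsForceField L K → ∀ t, 0 ≤ t →
      IntervalIntegrable (fun x => K x t) volume 0 L := fun hK t ht => by
    have h2 : Continuous fun x : ℝ => ((x, t) : ℝ × ℝ) := by fun_prop
    exact (hK.continuousOn.comp_continuous h2 fun x => ⟨mem_univ _, ht⟩).intervalIntegrable _ _
  have hdens : ∀ t, 0 ≤ t → (fun x => density δf x t)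
      = fun x => rhoFree δf₀ x t - rhoResponse μ G t x := fun t ht =>
    funext fun x => h.density_eq hL hμ hH x ht
  have hiF := intervalIntegrable_rhoFree hL hf₀
  have hiR : ∀ t, 0 ≤ t → IntervalIntegrable (rhoResponse μ G t) volume 0 L := fun t ht =>
    intervalIntegrable_rhoResponse hL hμ hc hp ht
  have hvol : ∀ t, 0 < t → (fourierX L ξ fun x => rhoFree δf₀ x t)
      = (fourierX L ξ fun x => density δf x t) + Complex.I * ξ
        * ∫ τ in (0 : ℝ)..t, (fourierX L ξ fun x => G x τ) * Uhat μ ξ (t - τ) := fun t ht => by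
    rw [hdens t ht.le, fourierX_sub ξ (hiF t) (hiR t ht.le),
      fourierX_rhoResponse hL he hμ hc hp ht.le]
    ring
  have hgauss : ∀ t, 0 < t → (fourierX L ξ fun x => density δf x t)
      = Complex.I * ξ * fourierX L ξ fun x => E x t := fun t ht => by
    refine fourierX_deriv he ?_ (h.poisson.gauss t ht.le) ?_
    · simpa using hE.periodic 0 t ht.le
    · rw [hdens t ht.le]
      exact (hiF t).sub (hiR t ht.le)
  have hfield : ∀ t, 0 < t → (fourierX L ξ fun x => G x t)
      = (Complex.I * ξ)⁻¹ * (fourierX L ξ fun x => density δf x t)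
        + fourierX L ξ fun x => H x t := fun t ht => by
    have : (fun x => G x t) = fun x => E x t + H x t :=
      funext fun x => extendField_of_nonneg _ x ht.le
    rw [this, fourierX_add ξ (hcont hE t ht.le) (hcont hH t ht.le), hgauss t ht,
      inv_mul_cancel_left₀ hIξ]
  have hρs' : LaplaceConv (fun t => fourierX L ξ fun x => density δf x t) s := hρs
  have hHs' : LaplaceConv (fun t => fourierX L ξ fun x => H x t) s := hHs
  -- Convergence of the transform of the self-consistent field follows from that of the density
  -- through Gauss's law, as `ξ ≠ 0`.
  have hEs := hρs'.const_mul (Complex.I * ξ)⁻¹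
  have hGs : LaplaceConv (fun t => fourierX L ξ fun x => G x t) s :=
    (hEs.add hHs').congr fun t ht => (hfield t ht).symm
  have hUs := laplaceConv_Uhat hμ hξ0 hs
  have hG' : Complex.I * ξ * laplace (fun t => fourierX L ξ fun x => G x t) s
      = LF L ξ (density δf) s + Complex.I * ξ * LF L ξ H s := by
    rw [laplace_congr hfield, laplace_add hEs hHs', laplace_const_mul, mul_add,
      mul_inv_cancel_left₀ hIξ]
    rfl
  -- Convergence for the free-streaming density need not be assumed: for positive times its
  -- coefficient equals a sum of functions whose transforms converge.
  rw [← hG', LF, laplace_congr hvol,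
    laplace_add hρs' ((laplaceConv_conv hGs hUs).const_mul _), laplace_const_mul,
    laplace_conv hGs hUs, ← mul_assoc]
  rfl

end VlasovControl

/-! ### Comparison of the two controls -/

open VlasovControl
theorem mainTheorem3 (k : ℕ) (L σ c : ℝ) (hL : 0 < L) (hσ : 0 < σ) (hc : 0 < c) :
    ∃ C : ℝ, 0 < C ∧
      ∀ (μ : ℝ → ℝ), IsEquilibrium μ →
      ∀ (j : ℤ) (ξ : ℝ), j ≠ 0 → ξ = 2 * π * j / L →
      ∀ (s : ℂ), σ ≤ s.re →
      -- the transforms of the truncated equilibria are bounded away from zero uniformly in `N`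
      (∀ N : ℕ, 1 ≤ N → c ≤ ‖LUtrunc μ N ξ s‖) →
      ∀ (N : ℕ), 1 ≤ N →
      ∀ (δf₀ : ℝ → ℝ → ℝ), IsInitialData L δf₀ →
      ∀ (Hvp Hmom : ℝ → ℝ → ℝ), IsForceField L Hvp → IsForceField L Hmom →
      ∀ (m : ℕ → ℝ → ℝ → ℝ) (EN : ℝ → ℝ → ℝ),
      IsLinearizedTruncated L μ N Hmom δf₀ m EN →
      LFConv L ξ Hvp s → LFConv L ξ Hmom s → LFConv L ξ (m N) s →
      -- the kinetic control
      Complex.I * ξ * LF L ξ Hvp s = -LF L ξ (rhoFree δf₀) s →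
      -- the moment control
      Complex.I * ξ * LF L ξ Hmom s = -LF L ξ (rhoFree δf₀) s
        + Complex.I * ξ * (√((N : ℝ) + 1) : ℝ) / LUtrunc μ N ξ s
          * LF L ξ (m N) s * LHerm (N + 1) ξ s →
      -- the difference of the two controls
      ‖LF L ξ Hmom s - LF L ξ Hvp s‖
          = ‖LHerm (N + 1) ξ s / LUtrunc μ N ξ s * (√((N : ℝ) + 1) : ℝ) * LF L ξ (m N) s‖ ∧
      -- its size
      (k ≤ N → ContDiff ℝ k μ →
        ENNReal.ofReal ‖LF L ξ Hmom s - LF L ξ Hvp s‖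
            ≤ ENNReal.ofReal (C * (√((N : ℝ) + 1) / (N : ℝ) ^ ((k : ℝ) / 2)))
              * ∫⁻ t in Ioi (0 : ℝ), ENNReal.ofReal (Real.exp (-(s.re * t))) * wNormAf L μ N m k t ∧
        ENNReal.ofReal ‖LF L ξ Hmom s - LF L ξ Hvp s‖
            ≤ ENNReal.ofReal (C * (√((N : ℝ) + 1) / (N : ℝ) ^ ((k : ℝ) / 2)))
              * ⨆ t ∈ Ioi (0 : ℝ), wNormAf L μ N m k t) ∧
      -- the density when the moment control drives the true linearised system
      (∀ (δf : ℝ → ℝ → ℝ → ℝ) (E : ℝ → ℝ → ℝ),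
        IsLinearizedVP L μ Hmom δf₀ δf E →
        LFConv L ξ (density δf) s →
        1 + LU μ ξ s ≠ 0 →
        LF L ξ (density δf) s = LF L ξ (rhoFree δf₀) s
          - LU μ ξ s / (1 + LU μ ξ s)
            * (Complex.I * ξ * LHerm (N + 1) ξ s / LUtrunc μ N ξ s)
            * (√((N : ℝ) + 1) : ℝ) * LF L ξ (m N) s) := by
  have hK : 0 < (1 + √(2 * π)) / 2 / σ / c := by positivity
  have hkk : 0 < √((k : ℝ) ^ k) := by
    apply Real.sqrt_pos.2
    rcases Nat.eq_zero_or_pos k with rfl | h0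
    · simp
    · positivity
  -- The first factor bounds the quotient of the Hermite transform by the truncated one; the second
  -- collects Cauchy-Schwarz in `x` and the factorial estimate.
  set C₀ := (1 + √(2 * π)) / 2 / σ / c * (√L * √((k : ℝ) ^ k)) with hC₀
  have hC₀pos : 0 < C₀ := by positivity
  -- The integral bound needs `C₀`, and the supremum bound needs `C₀ / σ` because the exponential is
  -- integrated in time; the sum serves both.
  refine ⟨C₀ * (1 + 1 / σ), by positivity, ?_⟩
  intro μ hμ j ξ hj hξ s hs hU N hN δf₀ hf₀ Hvp Hmom _ hHmom m EN hm _ hLmom _ hvp hmom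
  have hξ0 : ξ ≠ 0 := by
    rw [hξ]
    have : (j : ℝ) ≠ 0 := by exact_mod_cast hj
    positivity
  have hIξ : Complex.I * (ξ : ℂ) ≠ 0 :=
    mul_ne_zero Complex.I_ne_zero (by exact_mod_cast hξ0)
  have hdiff : LF L ξ Hmom s - LF L ξ Hvp s
      = LHerm (N + 1) ξ s / LUtrunc μ N ξ s * (√((N : ℝ) + 1) : ℝ) * LF L ξ (m N) s := by
    refine mul_left_cancel₀ hIξ ?_
    rw [mul_sub, hmom, hvp]
    ring
  refine ⟨by rw [hdiff], fun hkN hμk => ?_, ?_⟩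
  · set a := √((N : ℝ) + 1) / (N : ℝ) ^ ((k : ℝ) / 2) with ha
    have ha0 : 0 ≤ a := by positivity
    have hnorm : ‖LF L ξ Hmom s - LF L ξ Hvp s‖
        ≤ (1 + √(2 * π)) / 2 / σ / c * √((N : ℝ) + 1) * ‖LF L ξ (m N) s‖ := by
      rw [hdiff, norm_mul, norm_mul, norm_div, Complex.norm_real, Real.norm_eq_abs,
        abs_of_nonneg (Real.sqrt_nonneg _)]
      gcongr
      · exact norm_LHerm_le (N + 1) ξ hσ hs
      · exact hU N hN
    have hmain : ENNReal.ofReal ‖LF L ξ Hmom s - LF L ξ Hvp s‖ ≤ ENNReal.ofReal (C₀ * a)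
        * ∫⁻ t in Ioi (0 : ℝ), ENNReal.ofReal (Real.exp (-(s.re * t))) * wNormAf L μ N m k t := by
      refine (ENNReal.ofReal_le_ofReal hnorm).trans ?_
      rw [ENNReal.ofReal_mul (by positivity)]
      refine (mul_le_mul_right (ofReal_norm_LF_moment_le ξ hL hμ hkN hN hμk m s
        (hm.continuousOn N le_rfl)) _).trans (le_of_eq ?_)
      rw [← mul_assoc, ← ENNReal.ofReal_mul (by positivity)]
      congr 2
      rw [hC₀, ha]
      ring
    constructor
    · refine hmain.trans (mul_le_mul_left (ENNReal.ofReal_le_ofReal ?_) _)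
      gcongr
      exact le_mul_of_one_le_right hC₀pos.le (by simp [hσ.le])
    · refine hmain.trans ((mul_le_mul_right (lintegral_exp_mul_le_iSup hσ hs _) _).trans ?_)
      rw [← mul_assoc, ← ENNReal.ofReal_mul (by positivity)]
      refine mul_le_mul_left (ENNReal.ofReal_le_ofReal ?_) _
      have h1 : C₀ * a * (1 / σ) = C₀ * (1 / σ) * a := by ring
      rw [h1]
      gcongr
      linarith
  · intro δf E hδf hρ hU1
    have hvolt := hδf.laplace_volterra hL hξ0 (phase_period hL hξ) hμ hf₀ hHmom
      (hσ.trans_le hs) hLmom hρ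
    -- With the control inserted, `-LF L ξ (rhoFree δf₀) s` joins the density inside the bracket.
    -- The equation becomes `1 + LU` times the difference of the true and free densities equal to
    -- minus `LU` times the moment term.
    rw [hmom] at hvolt
    have hU0 : LUtrunc μ N ξ s ≠ 0 := by
      intro h0
      have := hU N hN
      rw [h0, norm_zero] at this
      linarith
    field_simp at hvolt ⊢
    linear_combination (-1 : ℂ) * hvolt
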